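/- **Setting.** Let $K\supseteq\mathbb{Q}$ be a differential field with $n$ commuting derivations $\partial_1,\dots,\partial_n$, and let $D=K[d_1,\dots,d_n]$ be the ring of linear differential operators ($d_ia=a\,d_i+\partial_ia$, $d_id_j=d_jd_i$). Let $\Phi^\tau=\sum_{i,k}a^{\tau i}_k\,y^k_i+\sum_k b^\tau_k\,y^k=0$ be a finite first order linear system in the unknowns $y^1,\dots,y^m$ with coefficients in $K$, and let $M=Dy/D\Phi$, where $Dy=Dy^1\oplus\dots\oplus Dy^m\simeq D^m$ and $y^k_i=d_iy^k$. Let $M_q\subseteq M$ be the image of the elements of $Dy$ of order at most $q$. The *inverse system* of $M$ is $R=\hom_K(M,K)$, the projective limit of the finite dimensional spaces $R_q=\hom_K(M_q,K)$; its elements are called *sections*. Let $A$ be an invertible $n\times n$ matrix of constants of $K$ and put $\delta_i=\sum_jA_{ij}d_j$. A *solved form* of the system in the coordinates given by $A$ is a family of equations $\Psi^\tau$ spanning the same $K$-vector space as the $\Phi^\tau$, each with a class $c\in\{0,\dots,n\}$, such that an equation of class $c$ contains no $\delta_iy^k$ with $i>c$, the coefficient rows of the $\delta_cy^k$ in the equations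 of class $c\ge1$ are linearly independent over $K$, and so are the equations of class $0$ (those of order zero). The multiplicative variables of an equation of class $c$ are the first $c$ ones. The solved form is *involutive* if every $\delta_j\Psi^\tau$ is a $K$-combination of the $\Psi^\sigma$ and of their derivatives with respect to their own multiplicative variables. The system is *involutive* if it has an involutive solved form for some $A$. **Theorem.** Suppose that the system is involutive and that no nonzero $K$-combination of the $\Phi^\tau$ has order zero. 1. $R$ is a left $D$-module for $(af)(x)=a\,f(x)$ and the Spencer operator $(d_if)(x)=\partial_i(f(x))-f(d_ix)$, where $a\in K$, $f\in R$, $x\in M$. 2. $R$ is generated over $D$ by $m$ sections: there are $f_1,\dots,f_m\in R$, linearly independent over $K$, such that $Df_1+\dots+Df_m$ projects onto $R_q$ for every $q\ge0$. That is, $Df_1+\dots+Df_m$ is dense in the projective limit $R$; equivalently, no nonzero element of $M$ is killed by all the elements of $Df_1+\dots+Df_m$. If $\dim_KM<\infty$, then $R=Df_1+\dots+Df_m$. 3. The generators correspond to the Cartan–Kähler data. Take any involutive solved form, let $\beta^i$ be its number of equations of class $i$ ($1\le i\le n$), and let $i(k)$ be the number of $i\in\{1,\dots,n\}$ with $\beta^i<k$.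 (Thus $i(k)=0$ for $k\le\beta^1$, $i(k)=i$ for $\beta^i<k\le\beta^{i+1}$, and $i(k)=n$ for $k>\beta^n$.) Then there is an invertible linear change of unknowns $z=By$ over $K$ such that for arbitrary data $c^k_\mu\in K$, where $1\le k\le m$ and $\mu\in\mathbb{N}^n$ with $\mu_j=0$ for $j>i(k)$ (for each $k$, a formal power series in $i(k)$ variables), there is one and only one section $f\in R$ with $f(\delta^\mu z^k)=c^k_\mu$ for all such $k,\mu$. Moreover there are $f_1,\dots,f_m\in R$, linearly independent over $K$ and generating $R$ in the sense of 2, such that all the data of $f_k$ vanish except possibly those attached to the index $k$. -/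

import Mathlib

/-- `n` commuting derivations on a field `K`: together with `K` this is a differential field. -/
structure CommDerivations (K : Type*) [Field K] (n : ℕ) where
  /-- the derivations `∂_1, …, ∂_n` -/
  der : Fin n → Derivation ℤ K K
  /-- they commute -/
  comm : ∀ i j a, der i (der j a) = der j (der i a)

section DiffOp

variable {K : Type*} [Field K] {n : ℕ}

/-- The defining relations of `D = K[d_1, …, d_n]`: the elements of `K` add and multiply as in `K`,
`d_i a = a d_i + ∂_i a`, and `d_i d_j = d_j d_i`. -/
inductive DiffOp.Rel (Δ : CommDerivations K n) :
    FreeAlgebra ℤ (K ⊕ Fin n) → FreeAlgebra ℤ (K ⊕ Fin n) → Prop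
  | one : DiffOp.Rel Δ (FreeAlgebra.ι ℤ (Sum.inl 1)) 1
  | add (a b : K) : DiffOp.Rel Δ (FreeAlgebra.ι ℤ (Sum.inl (a + b)))
      (FreeAlgebra.ι ℤ (Sum.inl a) + FreeAlgebra.ι ℤ (Sum.inl b))
  | mul (a b : K) : DiffOp.Rel Δ (FreeAlgebra.ι ℤ (Sum.inl (a * b)))
      (FreeAlgebra.ι ℤ (Sum.inl a) * FreeAlgebra.ι ℤ (Sum.inl b))
  | leibniz (i : Fin n) (a : K) :
      DiffOp.Rel Δ (FreeAlgebra.ι ℤ (Sum.inr i) * FreeAlgebra.ι ℤ (Sum.inl a))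
        (FreeAlgebra.ι ℤ (Sum.inl a) * FreeAlgebra.ι ℤ (Sum.inr i)
          + FreeAlgebra.ι ℤ (Sum.inl (Δ.der i a)))
  | comm (i j : Fin n) :
      DiffOp.Rel Δ (FreeAlgebra.ι ℤ (Sum.inr i) * FreeAlgebra.ι ℤ (Sum.inr j))
        (FreeAlgebra.ι ℤ (Sum.inr j) * FreeAlgebra.ι ℤ (Sum.inr i))

/-- The ring `D = K[d_1, …, d_n]` of linear differential operators with coefficients in `K`. -/
def DiffOp (Δ : CommDerivations K n) : Type _ := RingQuot (DiffOp.Rel Δ)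

namespace DiffOp

variable (Δ : CommDerivations K n)

noncomputable instance : Ring (DiffOp Δ) := inferInstanceAs (Ring (RingQuot (DiffOp.Rel Δ)))

/-- The quotient map from the free ring. -/
noncomputable def mk : FreeAlgebra ℤ (K ⊕ Fin n) →+* DiffOp Δ :=
  (RingQuot.mkRingHom (DiffOp.Rel Δ) : _ →+* RingQuot (DiffOp.Rel Δ))

theorem mk_rel {x y : FreeAlgebra ℤ (K ⊕ Fin n)} (h : DiffOp.Rel Δ x y) : mk Δ x = mk Δ y :=
  RingQuot.mkRingHom_rel h

/-- The inclusion `K ⊆ D` as operators of order zero. -/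
noncomputable def coeff : K →+* DiffOp Δ :=
  RingHom.mk'
    { toFun := fun a => mk Δ (FreeAlgebra.ι ℤ (Sum.inl a))
      map_one' := by rw [mk_rel Δ (Rel.one), map_one]
      map_mul' := fun a b => by rw [mk_rel Δ (Rel.mul a b), map_mul] }
    (fun a b => by
      change mk Δ (FreeAlgebra.ι ℤ (Sum.inl (a + b))) = _
      rw [mk_rel Δ (Rel.add a b), map_add]; rfl)

/-- The operators `d_1, …, d_n`. -/
noncomputable def d (i : Fin n) : DiffOp Δ := mk Δ (FreeAlgebra.ι ℤ (Sum.inr i))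

theorem d_mul_coeff (i : Fin n) (a : K) :
    d Δ i * coeff Δ a = coeff Δ a * d Δ i + coeff Δ (Δ.der i a) := by
  have h := mk_rel Δ (Rel.leibniz i a)
  rw [map_mul, map_add, map_mul] at h
  exact h

theorem d_mul_d (i j : Fin n) : d Δ i * d Δ j = d Δ j * d Δ i := by
  have h := mk_rel Δ (Rel.comm i j)
  rw [map_mul, map_mul] at h
  exact h

/-- `D` as a left vector space over `K`. -/
noncomputable instance : Module K (DiffOp Δ) := Module.compHom (DiffOp Δ) (coeff Δ)

theorem smul_def (a : K) (P : DiffOp Δ) : a • P = coeff Δ a * P := rfl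

instance : IsScalarTower K (DiffOp Δ) (DiffOp Δ) :=
  ⟨fun a P Q => by simp only [smul_def, smul_eq_mul, mul_assoc]⟩

/-- `D_q`: the operators of order at most `q`, that is the `K`-combinations of the products of at
most `q` of the `d_i`. -/
noncomputable def orderLE (q : ℕ) : Submodule K (DiffOp Δ) :=
  Submodule.span K {P | ∃ l : List (Fin n), l.length ≤ q ∧ P = (l.map (d Δ)).prod}

end DiffOp

end DiffOp

section Spencer

variable {K : Type*} [Field K] {n : ℕ} {Δ : CommDerivations K n}
variable {N : Type*} [AddCommGroup N] [Module (DiffOp Δ) N] [Module K N]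
  [IsScalarTower K (DiffOp Δ) N]

namespace Spencer

theorem coeff_smul (a : K) (x : N) : DiffOp.coeff Δ a • x = a • x := by
  have h := smul_assoc a (1 : DiffOp Δ) x
  rwa [DiffOp.smul_def, mul_one, one_smul] at h

theorem d_smul_smul (i : Fin n) (a : K) (x : N) :
    DiffOp.d Δ i • a • x = a • DiffOp.d Δ i • x + Δ.der i a • x := by
  rw [← coeff_smul (Δ := Δ) a x, smul_smul, DiffOp.d_mul_coeff, add_smul, mul_smul,
    coeff_smul, coeff_smul]

/-- The Spencer operator on `hom_K(N, K)`: `(d_i f)(x) = ∂_i (f x) - f (d_i x)`. -/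
noncomputable def op (i : Fin n) (f : N →ₗ[K] K) : N →ₗ[K] K where
  toFun x := Δ.der i (f x) - f (DiffOp.d Δ i • x)
  map_add' x y := by simp only [map_add, smul_add]; ring
  map_smul' a x := by
    simp only [d_smul_smul, map_add, map_smul, smul_eq_mul, Derivation.leibniz, RingHom.id_apply]
    ring

/-- The Spencer operator as an additive endomorphism. -/
noncomputable def opHom (i : Fin n) : Module.End ℤ (N →ₗ[K] K) :=
  AddMonoidHom.toIntLinearMap
    { toFun := op (Δ := Δ) i
      map_zero' := by ext x; simp [op]
      map_add' := fun f g => by ext x; simp [op]; ring }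

/-- Multiplication of linear forms by a scalar, as an additive endomorphism. -/
noncomputable def scalarHom (a : K) : Module.End ℤ (N →ₗ[K] K) :=
  AddMonoidHom.toIntLinearMap
    { toFun := fun f => a • f
      map_zero' := smul_zero a
      map_add' := fun f g => smul_add a f g }

@[simp] theorem opHom_apply (i : Fin n) (f : N →ₗ[K] K) (x : N) :
    opHom (Δ := Δ) i f x = Δ.der i (f x) - f (DiffOp.d Δ i • x) := rfl

theorem scalarHom_apply (a : K) (f : N →ₗ[K] K) (x : N) : scalarHom a f x = a * f x := rfl

/-- The additive endomorphisms attached to the generators of the free ring. -/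
noncomputable def freeAction :
    FreeAlgebra ℤ (K ⊕ Fin n) →ₐ[ℤ] Module.End ℤ (N →ₗ[K] K) :=
  FreeAlgebra.lift ℤ (Sum.elim scalarHom (opHom (Δ := Δ)))

theorem freeAction_inl (a : K) :
    freeAction (Δ := Δ) (N := N) (FreeAlgebra.ι ℤ (Sum.inl a)) = scalarHom a := by
  simp [freeAction]

theorem freeAction_inr (i : Fin n) :
    freeAction (Δ := Δ) (N := N) (FreeAlgebra.ι ℤ (Sum.inr i)) = opHom (Δ := Δ) i := by
  simp [freeAction]

/-- The action of `D` on `hom_K(N, K)` in which `a ∈ K` multiplies the values by `a` and `d_i` is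
the Spencer operator. -/
noncomputable def action : DiffOp Δ →+* Module.End ℤ (N →ₗ[K] K) :=
  RingQuot.lift
    ⟨(freeAction (Δ := Δ) (N := N) : FreeAlgebra ℤ (K ⊕ Fin n) →+* Module.End ℤ (N →ₗ[K] K)), by
      intro x y h
      simp only [RingHom.coe_coe]
      cases h with
      | one =>
        ext f x
        simp [freeAction_inl, scalarHom_apply]
      | add a b =>
        ext f x
        simp [freeAction_inl, scalarHom_apply, add_mul]
      | mul a b =>
        ext f x
        simp [freeAction_inl, scalarHom_apply, mul_assoc]
      | leibniz i a =>
        ext f x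
        simp [freeAction_inl, freeAction_inr, scalarHom_apply, Derivation.leibniz]
        ring
      | comm i j =>
        ext f x
        simp only [map_mul, freeAction_inr, Module.End.mul_apply, opHom_apply, map_sub, smul_smul]
        rw [Δ.comm i j, DiffOp.d_mul_d Δ i j]
        ring⟩

/-- `hom_K(N, K)` is a left `D`-module through the Spencer operator. -/
noncomputable instance : Module (DiffOp Δ) (N →ₗ[K] K) :=
  Module.compHom (N →ₗ[K] K) (action (Δ := Δ) (N := N))

end Spencer

end Spencer

/-- A first order linear system of `p` equations in `m` unknowns and `n` independent variables,
`Φ^τ = ∑ a^{τ i}_k y^k_i + ∑ b^τ_k y^k = 0`, with coefficients in `K`. -/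
structure FirstOrderSystem (K : Type*) (n m : ℕ) where
  /-- the number of equations -/
  p : ℕ
  /-- the coefficient of `y^k_i` in the equation `τ` is `a τ i k` -/
  a : Fin p → Fin n → Fin m → K
  /-- the coefficient of `y^k` in the equation `τ` is `b τ k` -/
  b : Fin p → Fin m → K

section System

variable {K : Type*} [Field K] {n m : ℕ}

/-- The element `∑ a_{i k} δ_i y^k + ∑ b_k y^k` of `D y^1 + … + D y^m = D^m`, where
`δ_1, …, δ_n` are given operators. -/
noncomputable def jetForm (Δ : CommDerivations K n) (δ : Fin n → DiffOp Δ)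
    (a : Fin n → Fin m → K) (b : Fin m → K) : Fin m → DiffOp Δ :=
  fun k => (∑ i, a i k • δ i) + DiffOp.coeff Δ (b k)

/-- The element `∑ b_k y^k` of order zero in `D^m`. -/
noncomputable def zeroForm (Δ : CommDerivations K n) (b : Fin m → K) : Fin m → DiffOp Δ :=
  fun k => DiffOp.coeff Δ (b k)

namespace FirstOrderSystem

variable (S : FirstOrderSystem K n m) (Δ : CommDerivations K n)

/-- The equation `Φ^τ` as an element of `D^m`. -/
noncomputable def eqn (τ : Fin S.p) : Fin m → DiffOp Δ :=
  jetForm Δ (DiffOp.d Δ) (S.a τ) (S.b τ)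

/-- The `K`-vector space of first order equations spanned by the `Φ^τ`. -/
noncomputable def eqSpace : Submodule K (Fin m → DiffOp Δ) :=
  Submodule.span K (Set.range (S.eqn Δ))

/-- No nonzero equation of order zero is a `K`-combination of the equations. -/
def NoZeroOrder : Prop := ∀ b : Fin m → K, zeroForm Δ b ∈ S.eqSpace Δ → b = 0

/-- The differential module of equations `D Φ ⊆ D y`. -/
noncomputable def eqModule : Submodule (DiffOp Δ) (Fin m → DiffOp Δ) :=
  Submodule.span (DiffOp Δ) (Set.range (S.eqn Δ))

/-- The differential module `M = D y / D Φ`. -/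
abbrev DModule : Type _ := (Fin m → DiffOp Δ) ⧸ S.eqModule Δ

/-- `M_q`: the image in `M` of the elements of `D y` of order at most `q`. -/
noncomputable def filt (q : ℕ) : Submodule K (S.DModule Δ) :=
  Submodule.span K {x | ∃ v : Fin m → DiffOp Δ, (∀ k, v k ∈ DiffOp.orderLE Δ q) ∧
    x = Submodule.Quotient.mk v}

/-- The inverse system `R = hom_K(M, K)`; its elements are the sections. -/
abbrev InverseSystem : Type _ := S.DModule Δ →ₗ[K] K

/-- The sections `f_1, f_2, …` generate the inverse system, the projective limit of the
`R_q = hom_K(M_q, K)`: the differential submodule `∑ D f_k` of `R` projects onto every `R_q`,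
that is, it is dense in `R`. -/
def Generates {ι : Type*} (f : ι → S.InverseSystem Δ) : Prop :=
  ∀ (q : ℕ) (g : S.filt Δ q →ₗ[K] K),
    ∃ h ∈ Submodule.span (DiffOp Δ) (Set.range f), h.domRestrict (S.filt Δ q) = g

/-- The derivations `δ_i = ∑ A_{i j} d_j` attached to a change of independent variables. -/
noncomputable def newD (A : Matrix (Fin n) (Fin n) K) (i : Fin n) : DiffOp Δ :=
  ∑ j, A i j • DiffOp.d Δ j

/-- A solved form of the system, after a linear change of the independent variables with constant
coefficients: a basis `Ψ^τ` of the space of equations sorted by classes `0, …, n`. With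
`δ_i = ∑ A_{i j} d_j`, an equation of class `c ≥ 1` contains no `δ_i y^k` with `i > c`, and the
equations of class `c` can be solved with respect to distinct jets of class `c`; the
equations of class `0` are those of order zero. The index `i : Fin n` stands for the variable
number `i + 1`. -/
structure SolvedForm where
  /-- the matrix of the change of variables -/
  A : Matrix (Fin n) (Fin n) K
  A_unit : IsUnit A.det
  A_const : ∀ l i j, Δ.der l (A i j) = 0
  /-- the number of equations -/
  q : ℕ
  /-- the class of an equation -/
  cls : Fin q → Fin (n + 1)
  /-- the coefficients of the `δ_i y^k` -/
  a : Fin q → Fin n → Fin m → K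
  /-- the coefficients of the `y^k` -/
  b : Fin q → Fin m → K
  span_eq : Submodule.span K (Set.range fun τ => jetForm Δ (newD Δ A) (a τ) (b τ)) = S.eqSpace Δ
  cls_le : ∀ τ (i : Fin n) k, (cls τ : ℕ) ≤ i → a τ i k = 0
  solved : ∀ i : Fin n,
    LinearIndependent K fun τ : {τ : Fin q // cls τ = i.succ} => a τ.1 i
  solved_zero : LinearIndependent K fun τ : {τ : Fin q // cls τ = 0} => b τ.1

namespace SolvedForm

variable {S Δ} (F : S.SolvedForm Δ)

/-- The derivations in the new coordinates. -/
noncomputable def δ (i : Fin n) : DiffOp Δ := newD Δ F.A i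

/-- The equations of the solved form. -/
noncomputable def eqn (τ : Fin F.q) : Fin m → DiffOp Δ := jetForm Δ F.δ (F.a τ) (F.b τ)

/-- The first prolongation is achieved by prolonging each equation of class `c` only with respect
to its multiplicative variables, which are the first `c` ones. -/
def IsInvolutive : Prop :=
  ∀ (τ : Fin F.q) (j : Fin n), F.δ j • F.eqn τ ∈
    Submodule.span K (Set.range F.eqn ∪
      {v | ∃ (σ : Fin F.q) (l : Fin n), (l : ℕ) < F.cls σ ∧ v = F.δ l • F.eqn σ})

/-- `β^i`: the number of equations of class `i`. -/
def β (i : Fin (n + 1)) : ℕ := (Finset.univ.filter fun τ : Fin F.q => F.cls τ = i).card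

/-- The type of the `k`-th unknown: the number of `i ∈ {1, …, n}` with `β^i < k` (for `k` counted
from `1`). The unknowns `1, …, β^1` have type `0`, the unknowns `β^i + 1, …, β^{i+1}` have type
`i`, and the unknowns `β^n + 1, …, m` have type `n`. -/
def type (k : Fin m) : ℕ := (Finset.univ.filter fun i : Fin n => F.β i.succ ≤ k).card

/-- Exponents of a formal power series in the first `type k` variables. -/
def CKIndex (k : Fin m) : Type := {μ : Fin n → ℕ // ∀ j : Fin n, F.type k ≤ j → μ j = 0}

/-- The residue in `M` of `δ^μ z^k`, where `z^k = ∑ B_{k l} y^l`. -/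
noncomputable def jet (B : Matrix (Fin m) (Fin m) K) (k : Fin m) (μ : Fin n → ℕ) :
    S.DModule Δ :=
  Submodule.Quotient.mk
    (((List.finRange n).map fun j => F.δ j ^ μ j).prod • zeroForm Δ (B k))

end SolvedForm

/-- The system is involutive: some solved form of it, in suitable coordinates, is. -/
def IsInvolutive : Prop := ∃ F : S.SolvedForm Δ, F.IsInvolutive

end FirstOrderSystem

end System

/-! ### Exponents of monomials and their weight. -/

section Exponents

variable {n : ℕ}

/-! Write `δ` for the derivations of a solved form. Two facts carry the proof: a `K`-basis of `M`
made of parametric jets, and sections with so lacunary data that they separate the points of `M`.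

Comparing second order parts in the involution condition shows that the leading rows of class `c`
lie in the span of those of class `j` for `c < j` (`IsInvolutive.row_mem_leadSpace`). The leading
spaces thus form a flag in `K^m`, and a basis adapted to it gives the new unknowns `z = By`. If the
last variable of `δ^μ z^k` has number greater than `i(k)`, the jet is principal: it is the leading
term, for the weight in which the `j`-th derivation counts `j`, of a multiplicative derivative of an
equation. These derivatives span all of `DΦ`, because rewriting a nonmultiplicative one gives
multiplicative ones and terms of lower weight. By triangularity they form, with the remaining jets,
a basis of `D^m`. Hence the parametric jets form a basis of `M` (`IsInvolutive.exists_basis_jets`),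
and a section is the same as arbitrary values on them.

Let `f_k` be `1` on the jets `δ^μ z^k` with `μ = (2^t, …, 2^t, 0, …, 0)`, with `i(k)` nonzero
entries, and `0` on the other parametric jets. The elements of `M` killed by `∑ D f_k` form a
differential submodule `N`. If `x ∈ N` is nonzero, take a component `k` of least type occurring in
`x`. On elements whose components all have at least this type, the first `i(k)` derivations act on
the `k`-th component as on polynomials. The components so obtained lie in a stable space of
polynomials killed by the lacunary form. Such a space is zero: a nonzero element of smallest
support, normalised to have a coefficient `1`, has constant coefficients, and a suitable shift
brings exactly one of its exponents to a lacunary position (`lacunaryRadical_eq_bot`). So `N = 0`,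
and duality in the finite dimensional `M_q` turns this into density. -/

theorem exponent_induction {p : (Fin n → ℕ) → Prop} (zero : p 0)
    (add : ∀ μ j, p μ → p (μ + Pi.single j 1)) (μ : Fin n → ℕ) : p μ := by
  induction hs : ∑ j, μ j generalizing μ with
  | zero =>
    have : μ = 0 := by
      funext j
      exact (Finset.sum_eq_zero_iff.1 hs) j (Finset.mem_univ j)
    exact this ▸ zero
  | succ s ih =>
    obtain ⟨j, -, hj⟩ : ∃ j ∈ Finset.univ, μ j ≠ 0 := by
      apply Finset.exists_ne_zero_of_sum_ne_zero
      omega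
    have hle : Pi.single j 1 ≤ μ := by
      intro l
      rcases eq_or_ne l j with rfl | hl
      · simpa using Nat.one_le_iff_ne_zero.2 hj
      · simp [hl]
    rw [← tsub_add_cancel_of_le hle]
    refine add _ j (ih _ ?_)
    have h1 : ∑ l, (μ - Pi.single j 1 : Fin n → ℕ) l + ∑ l, (Pi.single j 1 : Fin n → ℕ) l = s + 1 := by
      rw [← Finset.sum_add_distrib, ← hs]
      exact Finset.sum_congr rfl fun l _ => congrFun (tsub_add_cancel_of_le hle) l
    simp only [Finset.sum_pi_single', Finset.mem_univ, if_true] at h1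
    omega

/-- The product of the powers `f j ^ μ j`. -/
def monomialProd {R : Type*} [Monoid R] (f : Fin n → R) (μ : Fin n → ℕ) : R :=
  ((List.finRange n).map fun j => f j ^ μ j).prod

theorem monomialProd_zero {R : Type*} [Monoid R] (f : Fin n → R) : monomialProd f 0 = 1 := by
  simp [monomialProd]

theorem monomialProd_add_single {R : Type*} [Monoid R] (f : Fin n → R)
    (hf : ∀ i j, Commute (f i) (f j)) (μ : Fin n → ℕ) (j : Fin n) :
    monomialProd f (μ + Pi.single j 1) = f j * monomialProd f μ := by
  have key : ∀ l : List (Fin n), l.Nodup → j ∈ l →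
      (l.map fun i => f i ^ (μ + Pi.single j 1 : Fin n → ℕ) i).prod =
        f j * (l.map fun i => f i ^ μ i).prod := by
    intro l
    induction l with
    | nil => simp
    | cons i l ih =>
      intro hl hj
      rw [List.nodup_cons] at hl
      rw [List.map_cons, List.prod_cons, List.map_cons, List.prod_cons]
      rcases eq_or_ne j i with rfl | hij
      · have : (l.map fun i => f i ^ (μ + Pi.single j 1 : Fin n → ℕ) i) = l.map fun i => f i ^ μ i := by
          refine List.map_congr_left fun i hi => ?_
          have : i ≠ j := fun h => hl.1 (h ▸ hi)
          simp [this]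
        rw [this]
        simp [pow_succ', mul_assoc]
      · rw [ih hl.2 (by simpa [hij] using hj)]
        have : (μ + Pi.single j 1 : Fin n → ℕ) i = μ i := by simp [hij.symm]
        rw [this, ← mul_assoc, ← mul_assoc, ((hf j i).pow_right (μ i)).eq]
  exact key _ (List.nodup_finRange n) (List.mem_finRange j)

/-- The weight of an exponent, in which the `j`-th variable counts `j`, for `j` counted from `1`. -/
def weight (μ : Fin n → ℕ) : ℕ := ∑ j : Fin n, ((j : ℕ) + 1) * μ j

theorem weight_add (μ ν : Fin n → ℕ) : weight (μ + ν) = weight μ + weight ν := by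
  simp [weight, mul_add, Finset.sum_add_distrib]

theorem weight_single (j : Fin n) : weight (Pi.single j 1) = (j : ℕ) + 1 := by
  simp [weight, Pi.single_apply]

theorem weight_mono {μ ν : Fin n → ℕ} (h : μ ≤ ν) : weight μ ≤ weight ν :=
  Finset.sum_le_sum fun j _ => Nat.mul_le_mul_left _ (h j)

end Exponents

/-! ### Changes of derivations with constant coefficients. -/

section Change

variable {K : Type*} [Field K] {n : ℕ}

theorem Derivation.sum_apply {ι : Type*} (s : Finset ι) (f : ι → Derivation ℤ K K) (a : K) :
    (∑ i ∈ s, f i) a = ∑ i ∈ s, f i a :=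
  (congrFun (map_sum Derivation.coeFnAddMonoidHom f s) a).trans (Finset.sum_apply a s _)

/-- Differentiate `A * A⁻¹ = 1` and cancel the constant matrix `A`. -/
theorem CommDerivations.const_inv (Δ : CommDerivations K n) {A : Matrix (Fin n) (Fin n) K}
    (hA : IsUnit A.det) (hc : ∀ l i j, Δ.der l (A i j) = 0) (l i j : Fin n) :
    Δ.der l (A⁻¹ i j) = 0 := by
  have h1 : A * (A⁻¹).map (Δ.der l) = 0 := by
    ext a b
    have h := congrArg (Δ.der l) (congrFun (congrFun (Matrix.mul_nonsing_inv A hA) a) b)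
    rw [Matrix.mul_apply, map_sum] at h
    simp only [Derivation.leibniz, hc, smul_eq_mul, mul_zero, add_zero] at h
    rw [Matrix.mul_apply, Matrix.zero_apply]
    simp only [Matrix.map_apply]
    rw [h, Matrix.one_apply]
    split <;> simp
  have h2 : (A⁻¹).map (Δ.der l) = 0 := by
    rw [← Matrix.one_mul ((A⁻¹).map (Δ.der l)), ← Matrix.nonsing_inv_mul A hA, Matrix.mul_assoc,
      h1, Matrix.mul_zero]
  exact congrFun (congrFun h2 i) j

/-- The derivations `∑ A_{i j} ∂_j` for a matrix `A` of constants. -/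
def CommDerivations.change (Δ : CommDerivations K n) (A : Matrix (Fin n) (Fin n) K)
    (hc : ∀ l i j, Δ.der l (A i j) = 0) : CommDerivations K n where
  der i := ∑ j, A i j • Δ.der j
  comm i j a := by
    simp only [Derivation.sum_apply, Derivation.smul_apply, map_sum, smul_eq_mul,
      Derivation.leibniz, hc, mul_zero,
      Finset.sum_const_zero, add_zero, Finset.mul_sum]
    rw [Finset.sum_comm]
    refine Finset.sum_congr rfl fun k _ => Finset.sum_congr rfl fun l _ => ?_
    rw [Δ.comm l k]
    ring

theorem CommDerivations.change_apply (Δ : CommDerivations K n) (A : Matrix (Fin n) (Fin n) K)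
    (hc : ∀ l i j, Δ.der l (A i j) = 0) (i : Fin n) (a : K) :
    (Δ.change A hc).der i a = ∑ j, A i j * Δ.der j a := by
  simp [CommDerivations.change, Derivation.sum_apply]

open FirstOrderSystem DiffOp

variable {Δ : CommDerivations K n} {A : Matrix (Fin n) (Fin n) K}

theorem newD_mul_coeff (hc : ∀ l i j, Δ.der l (A i j) = 0) (i : Fin n) (a : K) :
    newD Δ A i * coeff Δ a = coeff Δ a * newD Δ A i + coeff Δ ((Δ.change A hc).der i a) := by
  simp only [newD, Finset.sum_mul, smul_def, mul_assoc, d_mul_coeff, mul_add,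
    Finset.sum_add_distrib, Finset.mul_sum, Δ.change_apply, map_sum, map_mul]
  congr 1
  refine Finset.sum_congr rfl fun k _ => ?_
  rw [← mul_assoc, ← mul_assoc, ← map_mul, ← map_mul, mul_comm]

theorem newD_commute (hc : ∀ l i j, Δ.der l (A i j) = 0) (i j : Fin n) :
    Commute (newD Δ A i) (newD Δ A j) := by
  have h : ∀ i j, newD Δ A i * newD Δ A j =
      ∑ k, ∑ l, coeff Δ (A i k * A j l) * (d Δ k * d Δ l) := by
    intro i j
    simp only [newD, Finset.sum_mul, Finset.mul_sum, smul_def]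
    refine (Finset.sum_comm).trans ?_
    refine Finset.sum_congr rfl fun k _ => Finset.sum_congr rfl fun l _ => ?_
    rw [mul_assoc, ← mul_assoc (d Δ k), d_mul_coeff, hc, map_zero, add_zero, map_mul]
    simp only [mul_assoc]
  rw [Commute, SemiconjBy, h, h, Finset.sum_comm]
  refine Finset.sum_congr rfl fun k _ => Finset.sum_congr rfl fun l _ => ?_
  rw [d_mul_d Δ, mul_comm (A i l)]

theorem d_eq_sum_newD (hA : IsUnit A.det) (j : Fin n) :
    d Δ j = ∑ i, A⁻¹ j i • newD Δ A i := by
  simp only [newD, Finset.smul_sum, smul_smul]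
  rw [Finset.sum_comm]
  simp only [← Finset.sum_smul, ← Matrix.mul_apply, Matrix.nonsing_inv_mul A hA]
  simp [Matrix.one_apply]

/-- The monomials in the derivations `δ_i = ∑ A_{i j} d_j`. -/
noncomputable def monomialD (Δ : CommDerivations K n) (A : Matrix (Fin n) (Fin n) K)
    (μ : Fin n → ℕ) : DiffOp Δ :=
  monomialProd (newD Δ A) μ

theorem monomialD_zero : monomialD Δ A 0 = 1 := monomialProd_zero _

theorem monomialD_add_single (hc : ∀ l i j, Δ.der l (A i j) = 0) (μ : Fin n → ℕ) (j : Fin n) :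
    monomialD Δ A (μ + Pi.single j 1) = newD Δ A j * monomialD Δ A μ :=
  monomialProd_add_single _ (newD_commute hc) μ j

theorem newD_smul_smul {N : Type*} [AddCommGroup N] [Module (DiffOp Δ) N] [Module K N]
    [IsScalarTower K (DiffOp Δ) N]
    (hc : ∀ l i j, Δ.der l (A i j) = 0) (i : Fin n) (a : K) (x : N) :
    newD Δ A i • a • x = a • newD Δ A i • x + (Δ.change A hc).der i a • x := by
  rw [← Spencer.coeff_smul (Δ := Δ) a x, smul_smul, newD_mul_coeff hc, add_smul, mul_smul,
    Spencer.coeff_smul, Spencer.coeff_smul]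

end Change

/-! ### The universal property of the ring of operators. -/

section UniversalProperty

variable {K : Type*} [Field K] {n : ℕ} {Δ : CommDerivations K n} {R : Type*} [Ring R]

namespace DiffOp

/-- The universal property of the ring of differential operators. -/
noncomputable def lift (κ : K →+* R) (D : Fin n → R)
    (hκ : ∀ i a, D i * κ a = κ a * D i + κ (Δ.der i a)) (hD : ∀ i j, D i * D j = D j * D i) :
    DiffOp Δ →+* R :=
  RingQuot.lift
    ⟨(FreeAlgebra.lift ℤ (Sum.elim κ D) : FreeAlgebra ℤ (K ⊕ Fin n) →+* R), by
      intro x y h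
      simp only [RingHom.coe_coe]
      cases h with
      | one => simp
      | add a b => simp
      | mul a b => simp
      | leibniz i a => simpa using hκ i a
      | comm i j => simpa using hD i j⟩

variable {κ : K →+* R} {D : Fin n → R}
    {hκ : ∀ i a, D i * κ a = κ a * D i + κ (Δ.der i a)} {hD : ∀ i j, D i * D j = D j * D i}

theorem lift_mk (x : FreeAlgebra ℤ (K ⊕ Fin n)) :
    lift κ D hκ hD (mk Δ x) = FreeAlgebra.lift ℤ (Sum.elim κ D) x :=
  RingQuot.lift_mkRingHom_apply _ _ _

theorem lift_coeff (a : K) : lift κ D hκ hD (coeff Δ a) = κ a :=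
  (lift_mk _).trans (by simp)

theorem lift_d (i : Fin n) : lift κ D hκ hD (d Δ i) = D i :=
  (lift_mk _).trans (by simp)

theorem mk_surjective : Function.Surjective (mk Δ) := RingQuot.mkRingHom_surjective _

/-- An additive predicate on operators that contains `1` and is stable under left multiplication by
the elements of `K` and by the `d_i` holds everywhere. -/
theorem left_induction {N : Type*} [AddCommGroup N] [Module (DiffOp Δ) N] {p : N → Prop}
    (add : ∀ x y, p x → p y → p (x + y))
    (coeff_smul : ∀ (a : K) x, p x → p (coeff Δ a • x)) (d_smul : ∀ i x, p x → p (d Δ i • x))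
    (P : DiffOp Δ) (x : N) (hx : p x) : p (P • x) := by
  obtain ⟨P, rfl⟩ := mk_surjective P
  induction P using FreeAlgebra.induction generalizing x with
  | grade0 r =>
    -- Integer scalars of the free algebra are absorbed by the elements of `K`.
    have h1 : mk Δ (algebraMap ℤ _ r) = coeff Δ (r : K) := by
      rw [map_intCast]
      exact map_intCast (mk Δ) r
    rw [h1]
    exact coeff_smul _ _ hx
  | grade1 s =>
    cases s with
    | inl a => exact coeff_smul a x hx
    | inr i => exact d_smul i x hx
  | mul P Q hP hQ =>
    rw [map_mul, mul_smul]
    exact hP _ (hQ _ hx)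
  | add P Q hP hQ =>
    rw [map_add, add_smul]
    exact add _ _ (hP _ hx) (hQ _ hx)

end DiffOp

end UniversalProperty

/-! ### Polynomials as a model of the free differential module of rank one. -/

section FreeModel

variable {K : Type*} [Field K] {n : ℕ}

/-- A derivation applied to the coefficients of a polynomial. -/
noncomputable def coeffDer (δ : Derivation ℤ K K) : Module.End ℤ ((Fin n → ℕ) →₀ K) :=
  Finsupp.mapRange.linearMap (δ : K →ₗ[ℤ] K)

/-- Multiplication of a polynomial by the `j`-th variable. -/
noncomputable def shift (K : Type*) [Field K] (j : Fin n) :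
    ((Fin n → ℕ) →₀ K) →ₗ[K] ((Fin n → ℕ) →₀ K) :=
  Finsupp.lmapDomain K K (· + Pi.single j 1)

/-- The action of the `j`-th derivation on polynomials. -/
noncomputable def stepOp (Δ : CommDerivations K n) (j : Fin n) :
    Module.End ℤ ((Fin n → ℕ) →₀ K) :=
  coeffDer (Δ.der j) + (shift K j).restrictScalars ℤ

@[simp] theorem coeffDer_apply (δ : Derivation ℤ K K) (p : (Fin n → ℕ) →₀ K) (μ : Fin n → ℕ) :
    coeffDer δ p μ = δ (p μ) := rfl

@[simp] theorem coeffDer_single (δ : Derivation ℤ K K) (μ : Fin n → ℕ) (a : K) :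
    coeffDer δ (Finsupp.single μ a) = Finsupp.single μ (δ a) :=
  Finsupp.mapRange_single (hf := map_zero δ)

@[simp] theorem shift_single (j : Fin n) (μ : Fin n → ℕ) (a : K) :
    shift K j (Finsupp.single μ a) = Finsupp.single (μ + Pi.single j 1) a :=
  Finsupp.mapDomain_single

theorem coeffDer_smul (δ : Derivation ℤ K K) (a : K) (p : (Fin n → ℕ) →₀ K) :
    coeffDer δ (a • p) = a • coeffDer δ p + δ a • p := by
  ext μ
  simp [mul_comm]

theorem coeffDer_shift (δ : Derivation ℤ K K) (j : Fin n) (p : (Fin n → ℕ) →₀ K) :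
    coeffDer δ (shift K j p) = shift K j (coeffDer δ p) := by
  induction p using Finsupp.induction_linear with
  | zero => simp
  | add p q hp hq => simp only [map_add, hp, hq]
  | single μ a => simp

theorem stepOp_apply (Δ : CommDerivations K n) (j : Fin n) (p : (Fin n → ℕ) →₀ K) :
    stepOp Δ j p = coeffDer (Δ.der j) p + shift K j p := rfl

theorem stepOp_smul (Δ : CommDerivations K n) (j : Fin n) (a : K) (p : (Fin n → ℕ) →₀ K) :
    stepOp Δ j (a • p) = a • stepOp Δ j p + Δ.der j a • p := by
  rw [stepOp_apply, stepOp_apply, coeffDer_smul, map_smul, smul_add]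
  abel

theorem coeffDer_comm (Δ : CommDerivations K n) (i j : Fin n) (p : (Fin n → ℕ) →₀ K) :
    coeffDer (Δ.der i) (coeffDer (Δ.der j) p) = coeffDer (Δ.der j) (coeffDer (Δ.der i) p) := by
  ext μ
  exact Δ.comm i j _

theorem coeffDer_stepOp (Δ : CommDerivations K n) (i j : Fin n) (p : (Fin n → ℕ) →₀ K) :
    coeffDer (Δ.der i) (stepOp Δ j p) = stepOp Δ j (coeffDer (Δ.der i) p) := by
  rw [stepOp_apply, stepOp_apply, map_add, coeffDer_comm, coeffDer_shift]

theorem shift_comm (i j : Fin n) (p : (Fin n → ℕ) →₀ K) :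
    shift K i (shift K j p) = shift K j (shift K i p) := by
  induction p using Finsupp.induction_linear with
  | zero => simp
  | add p q hp hq => simp only [map_add, hp, hq]
  | single μ a => simp only [shift_single, add_right_comm]

theorem stepOp_comm (Δ : CommDerivations K n) (i j : Fin n) (p : (Fin n → ℕ) →₀ K) :
    stepOp Δ i (stepOp Δ j p) = stepOp Δ j (stepOp Δ i p) := by
  simp only [stepOp_apply, map_add, coeffDer_comm Δ i j, shift_comm i j, coeffDer_shift]
  abel

end FreeModel

/-! ### Monomials form a basis of the ring of operators. -/

section Basis

open FirstOrderSystem DiffOp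

variable {K : Type*} [Field K] {n : ℕ} {Δ : CommDerivations K n} {A : Matrix (Fin n) (Fin n) K}

theorem toModuleEnd_apply_apply {N : Type*} [AddCommGroup N] [Module K N] (a : K) (x : N) :
    Module.toModuleEnd ℤ N a x = a • x := rfl

/-- The action on polynomials of the `j`-th original derivation. -/
noncomputable def originalOp (hc : ∀ l i j, Δ.der l (A i j) = 0) (j : Fin n) :
    Module.End ℤ ((Fin n → ℕ) →₀ K) :=
  ∑ i, Module.toModuleEnd ℤ _ (A⁻¹ j i) * stepOp (Δ.change A hc) i

theorem originalOp_apply (hc : ∀ l i j, Δ.der l (A i j) = 0) (j : Fin n)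
    (p : (Fin n → ℕ) →₀ K) :
    originalOp hc j p = ∑ i, A⁻¹ j i • stepOp (Δ.change A hc) i p := by
  simp only [originalOp, Module.End.mul_apply, LinearMap.sum_apply, toModuleEnd_apply_apply]

theorem originalOp_smul (hA : IsUnit A.det) (hc : ∀ l i j, Δ.der l (A i j) = 0) (j : Fin n)
    (a : K) (p : (Fin n → ℕ) →₀ K) :
    originalOp hc j (a • p) = a • originalOp hc j p + Δ.der j a • p := by
  have h : ∑ i, A⁻¹ j i * (Δ.change A hc).der i a = Δ.der j a := by
    simp only [Δ.change_apply, Finset.mul_sum]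
    rw [Finset.sum_comm]
    simp only [← mul_assoc, ← Finset.sum_mul, ← Matrix.mul_apply, Matrix.nonsing_inv_mul A hA]
    simp [Matrix.one_apply]
  simp only [originalOp_apply, stepOp_smul, smul_add, Finset.sum_add_distrib,
    ← h, Finset.sum_smul, Finset.smul_sum, smul_smul, mul_comm a]

theorem originalOp_comm (hA : IsUnit A.det) (hc : ∀ l i j, Δ.der l (A i j) = 0) (i j : Fin n)
    (p : (Fin n → ℕ) →₀ K) :
    originalOp hc i (originalOp hc j p) = originalOp hc j (originalOp hc i p) := by
  have h0 : ∀ k j l, (Δ.change A hc).der k (A⁻¹ j l) = 0 := by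
    intro k j l
    simp [Δ.change_apply, Δ.const_inv hA hc]
  simp only [originalOp_apply, map_sum, stepOp_smul, h0, zero_smul, add_zero,
    smul_smul]
  rw [Finset.sum_comm]
  refine Finset.sum_congr rfl fun k _ => Finset.sum_congr rfl fun l _ => ?_
  rw [mul_comm, stepOp_comm]

/-- The representation of the differential operators on polynomials in which `∑ A_{i j} d_j` acts
as the `i`-th derivation. -/
noncomputable def polyRep (hA : IsUnit A.det) (hc : ∀ l i j, Δ.der l (A i j) = 0) :
    DiffOp Δ →+* Module.End ℤ ((Fin n → ℕ) →₀ K) :=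
  DiffOp.lift (Module.toModuleEnd ℤ _) (originalOp hc)
    (fun j a => LinearMap.ext fun p => originalOp_smul hA hc j a p)
    (fun i j => LinearMap.ext fun p => originalOp_comm hA hc i j p)

theorem polyRep_coeff (hA : IsUnit A.det) (hc : ∀ l i j, Δ.der l (A i j) = 0) (a : K)
    (p : (Fin n → ℕ) →₀ K) : polyRep hA hc (coeff Δ a) p = a • p := by
  rw [polyRep, lift_coeff]
  rfl

theorem polyRep_newD (hA : IsUnit A.det) (hc : ∀ l i j, Δ.der l (A i j) = 0) (i : Fin n) :
    polyRep hA hc (newD Δ A i) = stepOp (Δ.change A hc) i := by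
  refine LinearMap.ext fun p => ?_
  simp only [newD, smul_def, map_sum, map_mul]
  simp only [polyRep, lift_coeff, lift_d, Module.End.mul_apply, LinearMap.sum_apply,
    originalOp_apply, toModuleEnd_apply_apply, Finset.smul_sum, smul_smul]
  rw [Finset.sum_comm]
  simp only [← Finset.sum_smul, ← Matrix.mul_apply, Matrix.mul_nonsing_inv A hA]
  simp [Matrix.one_apply]

/-- Derivations kill the coefficient `1`, so each `δ_j` acts here as a pure shift. -/
theorem polyRep_monomialD (hA : IsUnit A.det) (hc : ∀ l i j, Δ.der l (A i j) = 0)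
    (μ : Fin n → ℕ) :
    polyRep hA hc (monomialD Δ A μ) (Finsupp.single 0 1) = Finsupp.single μ 1 := by
  induction μ using exponent_induction with
  | zero => rw [monomialD_zero, map_one]; rfl
  | add μ j ih =>
    rw [monomialD_add_single hc, map_mul, Module.End.mul_apply, ih, polyRep_newD, stepOp_apply]
    simp

theorem monomialD_linearIndependent (hA : IsUnit A.det) (hc : ∀ l i j, Δ.der l (A i j) = 0) :
    LinearIndependent K (monomialD Δ A) := by
  let φ : DiffOp Δ →ₗ[K] ((Fin n → ℕ) →₀ K) :=
    { toFun := fun P => polyRep hA hc P (Finsupp.single 0 1)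
      map_add' := fun P Q => by rw [map_add]; rfl
      map_smul' := fun a P => by
        rw [smul_def, map_mul, Module.End.mul_apply, polyRep_coeff]; rfl }
  refine LinearIndependent.of_comp φ ?_
  have h : φ ∘ monomialD Δ A = fun μ => Finsupp.single μ 1 :=
    funext fun μ => polyRep_monomialD hA hc μ
  rw [h]
  exact (Finsupp.basisSingleOne (R := K) (ι := Fin n → ℕ)).linearIndependent

/-- Since `δ_i` is not `K`-linear, a check on generators does not suffice: the Leibniz rule adds a
multiple of the generator itself, whence the condition `s ⊆ W`. -/
theorem span_newD_smul_le {N : Type*} [AddCommGroup N] [Module (DiffOp Δ) N] [Module K N]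
    [IsScalarTower K (DiffOp Δ) N] (hc : ∀ l i j, Δ.der l (A i j) = 0) (i : Fin n) {s : Set N}
    {W : Submodule K N} (hs : s ⊆ W) (h : ∀ x ∈ s, newD Δ A i • x ∈ W) {x : N}
    (hx : x ∈ Submodule.span K s) : newD Δ A i • x ∈ W := by
  induction hx using Submodule.span_induction with
  | mem x hx => exact h x hx
  | zero => rw [smul_zero]; exact W.zero_mem
  | add x y _ _ hx hy => rw [smul_add]; exact W.add_mem hx hy
  | smul a x hx' hx =>
    rw [newD_smul_smul hc]
    exact W.add_mem (W.smul_mem _ hx) (W.smul_mem _ (Submodule.span_le.2 hs hx'))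

theorem newD_induction {N : Type*} [AddCommGroup N] [Module (DiffOp Δ) N] [Module K N]
    [IsScalarTower K (DiffOp Δ) N] (hA : IsUnit A.det)
    {W : Submodule K N} (h : ∀ i, ∀ x ∈ W, newD Δ A i • x ∈ W) (P : DiffOp Δ) {x : N}
    (hx : x ∈ W) : P • x ∈ W := by
  refine left_induction (p := (· ∈ W)) (fun _ _ => W.add_mem) ?_ ?_ P x hx
  · intro a x hx
    rw [Spencer.coeff_smul]
    exact W.smul_mem a hx
  · intro i x hx
    rw [d_eq_sum_newD hA, Finset.sum_smul]
    refine W.sum_mem fun j _ => ?_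
    rw [smul_assoc]
    exact W.smul_mem _ (h j x hx)

theorem span_monomialD (hA : IsUnit A.det) (hc : ∀ l i j, Δ.der l (A i j) = 0) :
    ⊤ ≤ Submodule.span K (Set.range (monomialD Δ A)) := by
  intro P _
  have h1 : (1 : DiffOp Δ) ∈ Submodule.span K (Set.range (monomialD Δ A)) :=
    Submodule.subset_span ⟨0, monomialD_zero⟩
  rw [← mul_one P]
  refine newD_induction hA (fun i x hx => ?_) P h1
  refine span_newD_smul_le hc i Submodule.subset_span ?_ hx
  rintro _ ⟨μ, rfl⟩
  exact Submodule.subset_span ⟨_, monomialD_add_single hc μ i⟩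

/-- The monomials in the `∑ A_{i j} d_j` form a basis of the ring of differential operators. -/
noncomputable def monomialBasis (hA : IsUnit A.det) (hc : ∀ l i j, Δ.der l (A i j) = 0) :
    Module.Basis (Fin n → ℕ) K (DiffOp Δ) :=
  Module.Basis.mk (monomialD_linearIndependent hA hc) (span_monomialD hA hc)

theorem monomialBasis_apply (hA : IsUnit A.det) (hc : ∀ l i j, Δ.der l (A i j) = 0)
    (μ : Fin n → ℕ) : monomialBasis hA hc μ = monomialD Δ A μ :=
  Module.Basis.mk_apply _ _ _

end Basis

/-! ### Unitriangular families and bases adapted to a flag. -/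

section LinearAlgebra

variable {K V : Type*} [Field K] [AddCommGroup V] [Module K V]

/-- A family that differs from a basis by terms of lower rank is a basis. -/
theorem Module.Basis.exists_of_unitriangular {ι : Type*} (e : Module.Basis ι K V) (rk : ι → ℕ)
    (g : ι → V) (h : ∀ i, g i - e i ∈ Submodule.span K (e '' {j | rk j < rk i})) :
    ∃ b : Module.Basis ι K V, ⇑b = g := by
  -- The map `e i ↦ g i` differs from the identity by a map lowering this exhaustive filtration,
  -- which starts at `0`; hence it is bijective.
  let F : ℕ → Submodule K V := fun r => Submodule.span K (e '' {j | rk j < r})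
  have hF : ∀ r s, r ≤ s → F r ≤ F s := fun r s hrs =>
    Submodule.span_mono (Set.image_mono fun j (hj : rk j < r) => hj.trans_le hrs)
  have hF_ex : ∀ x, ∃ r, x ∈ F r := by
    intro x
    have hx : x ∈ Submodule.span K (Set.range e) := e.span_eq ▸ Submodule.mem_top
    induction hx using Submodule.span_induction with
    | mem x hx =>
      obtain ⟨i, rfl⟩ := hx
      exact ⟨rk i + 1, Submodule.subset_span ⟨i, Nat.lt_succ_self _, rfl⟩⟩
    | zero => exact ⟨0, Submodule.zero_mem _⟩
    | add x y _ _ hx hy =>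
      obtain ⟨r, hr⟩ := hx
      obtain ⟨s, hs⟩ := hy
      exact ⟨max r s, Submodule.add_mem _ (hF _ _ (le_max_left r s) hr)
        (hF _ _ (le_max_right r s) hs)⟩
    | smul a x _ hx =>
      obtain ⟨r, hr⟩ := hx
      exact ⟨r, Submodule.smul_mem _ a hr⟩
  let G : V →ₗ[K] V := e.constr K g
  have hG : ∀ i, G (e i) = g i := fun i => e.constr_basis K g i
  have hlow : ∀ r, ∀ x ∈ F (r + 1), G x - x ∈ F r := by
    intro r x hx
    have : F (r + 1) ≤ (F r).comap (G - LinearMap.id) := by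
      refine Submodule.span_le.2 ?_
      rintro _ ⟨i, hi, rfl⟩
      change G (e i) - e i ∈ F r
      rw [hG]
      exact hF _ _ (Nat.lt_succ_iff.1 hi) (h i)
    exact this hx
  have hzero : F 0 = ⊥ := by
    simp [F]
  have hinj : Function.Injective G := by
    refine (injective_iff_map_eq_zero G).2 fun x hx => ?_
    have key : ∀ r, x ∈ F r → x = 0 := by
      intro r
      induction r with
      | zero => intro h; rwa [hzero, Submodule.mem_bot] at h
      | succ r ih =>
        intro h
        have := hlow r x h
        rw [hx, zero_sub, Submodule.neg_mem_iff] at this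
        exact ih this
    obtain ⟨r, hr⟩ := hF_ex x
    exact key r hr
  have hsurj : Function.Surjective G := by
    have key : ∀ r, F r ≤ LinearMap.range G := by
      intro r
      induction r with
      | zero => rw [hzero]; exact bot_le
      | succ r ih =>
        intro x hx
        have h1 : x = G x - (G x - x) := by abel
        rw [h1]
        exact Submodule.sub_mem _ ⟨x, rfl⟩ (ih (hlow r x hx))
    intro x
    obtain ⟨r, hr⟩ := hF_ex x
    exact key r hr
  refine ⟨e.map (LinearEquiv.ofBijective G ⟨hinj, hsurj⟩), funext fun i => ?_⟩
  rw [Module.Basis.map_apply]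
  exact hG i

/-- Greedy choice: `U k` has dimension greater than `k`, so the `k` vectors already chosen cannot
span it. -/
theorem exists_linearIndependent_mem_flag [FiniteDimensional K V] (m : ℕ)
    (U : ℕ → Submodule K V) (hU : ∀ k < m, k < Module.finrank K (U k)) :
    ∃ b : Fin m → V, LinearIndependent K b ∧ ∀ k : Fin m, b k ∈ U k := by
  induction m with
  | zero => exact ⟨Fin.elim0, linearIndependent_empty_type, fun k => k.elim0⟩
  | succ m ih =>
    obtain ⟨b, hb, hbU⟩ := ih fun k hk => hU k (hk.trans (Nat.lt_succ_self m))
    obtain ⟨v, hv, hvb⟩ : ∃ v ∈ U m, v ∉ Submodule.span K (Set.range b) := by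
      by_contra! hcon
      have h1 := Submodule.finrank_mono (show U m ≤ Submodule.span K (Set.range b) from hcon)
      rw [finrank_span_eq_card hb, Fintype.card_fin] at h1
      have h2 := hU m (Nat.lt_succ_self m)
      omega
    refine ⟨Fin.snoc b v, linearIndependent_finSnoc.2 ⟨hb, hvb⟩, fun k => ?_⟩
    refine Fin.lastCases ?_ (fun i => ?_) k
    · simpa using hv
    · simpa using hbU i

/-- A basis adapted to a flag. -/
theorem exists_basis_adapted_flag [FiniteDimensional K V] {m n : ℕ}
    (hm : Module.finrank K V = m) (W : Fin n → Submodule K V) (hW : Monotone W) :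
    ∃ b : Fin m → V, LinearIndependent K b ∧
      ∀ i, W i = Submodule.span K (b '' {k | (k : ℕ) < Module.finrank K (W i)}) := by
  -- For `U k` take the first `W i` of dimension greater than `k`, or the whole space if there is
  -- none.
  have hU : ∀ k : ℕ, ∃ U : Submodule K V, (k < m → k < Module.finrank K U) ∧
      ∀ i, k < Module.finrank K (W i) → U ≤ W i := by
    intro k
    by_cases h : ∃ i, k < Module.finrank K (W i)
    · obtain ⟨i, hi, hmin⟩ := WellFounded.has_min (wellFounded_lt (α := Fin n))
        {i | k < Module.finrank K (W i)} h
      exact ⟨W i, fun _ => hi, fun j hj => hW (not_lt.1 (hmin j hj))⟩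
    · refine ⟨⊤, fun hk => ?_, fun i hi => (h ⟨i, hi⟩).elim⟩
      rwa [finrank_top, hm]
  choose U hU1 hU2 using hU
  obtain ⟨b, hb, hbU⟩ := exists_linearIndependent_mem_flag m U hU1
  refine ⟨b, hb, fun i => Eq.symm ?_⟩
  refine Submodule.eq_of_le_of_finrank_eq ?_ ?_
  · refine Submodule.span_le.2 ?_
    rintro _ ⟨k, hk, rfl⟩
    exact hU2 k i hk (hbU k)
  · have hle : Module.finrank K (W i) ≤ m := hm ▸ Submodule.finrank_le (W i)
    rw [Set.image_eq_range]
    refine (finrank_span_eq_card (hb.comp _ Subtype.val_injective)).trans ?_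
    have : Fintype.card {k : Fin m // (k : ℕ) < Module.finrank K (W i)} =
        Module.finrank K (W i) := by
      rw [Fintype.card_subtype, Fin.card_filter_val_lt, min_eq_right hle]
    convert this
    exact Iff.rfl

end LinearAlgebra

/-! ### Jets of the changed unknowns. -/

section FreeBasis

open FirstOrderSystem DiffOp

variable {K : Type*} [Field K] {n m : ℕ} {Δ : CommDerivations K n} {A : Matrix (Fin n) (Fin n) K}

theorem zeroForm_add (r s : Fin m → K) : zeroForm Δ (r + s) = zeroForm Δ r + zeroForm Δ s :=
  funext fun _ => map_add _ _ _

theorem zeroForm_smul (a : K) (r : Fin m → K) : zeroForm Δ (a • r) = a • zeroForm Δ r :=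
  funext fun _ => map_mul _ _ _

/-- The inclusion of the forms of order zero. -/
noncomputable def zeroFormHom (Δ : CommDerivations K n) (m : ℕ) :
    (Fin m → K) →ₗ[K] (Fin m → DiffOp Δ) where
  toFun := zeroForm Δ
  map_add' := zeroForm_add
  map_smul' := zeroForm_smul

theorem zeroFormHom_apply (r : Fin m → K) : zeroFormHom Δ m r = zeroForm Δ r := rfl

/-- The change of unknowns `z = B y`. -/
noncomputable def changeUnknowns (Δ : CommDerivations K n) {B : Matrix (Fin m) (Fin m) K}
    (hB : IsUnit B.det) : (Fin m → DiffOp Δ) ≃ₗ[DiffOp Δ] (Fin m → DiffOp Δ) :=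
  LinearEquiv.ofLinearMap (Matrix.vecMulLinear (B.map (coeff Δ)))
    (Matrix.vecMulLinear (B⁻¹.map (coeff Δ)))
    (by
      refine LinearMap.ext fun v => ?_
      simp only [LinearMap.comp_apply, Matrix.vecMulLinear_apply, Matrix.vecMul_vecMul,
        ← Matrix.map_mul, Matrix.nonsing_inv_mul B hB, LinearMap.id_apply]
      rw [Matrix.map_one _ (map_zero _) (map_one _), Matrix.vecMul_one])
    (by
      refine LinearMap.ext fun v => ?_
      simp only [LinearMap.comp_apply, Matrix.vecMulLinear_apply, Matrix.vecMul_vecMul,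
        ← Matrix.map_mul, Matrix.mul_nonsing_inv B hB, LinearMap.id_apply]
      rw [Matrix.map_one _ (map_zero _) (map_one _), Matrix.vecMul_one])

/-- The jets `δ^μ z^k` of the unknowns `z = B y` form a basis of `D^m`. -/
noncomputable def jetBasis (hA : IsUnit A.det) (hc : ∀ l i j, Δ.der l (A i j) = 0)
    {B : Matrix (Fin m) (Fin m) K} (hB : IsUnit B.det) :
    Module.Basis (Σ _ : Fin m, (Fin n → ℕ)) K (Fin m → DiffOp Δ) :=
  (Pi.basis fun _ : Fin m => monomialBasis hA hc).map ((changeUnknowns Δ hB).restrictScalars K)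

theorem jetBasis_apply (hA : IsUnit A.det) (hc : ∀ l i j, Δ.der l (A i j) = 0)
    {B : Matrix (Fin m) (Fin m) K} (hB : IsUnit B.det) (i : Σ _ : Fin m, (Fin n → ℕ)) :
    jetBasis hA hc hB i = monomialD Δ A i.2 • zeroForm Δ (B i.1) := by
  rw [jetBasis, Module.Basis.map_apply, Pi.basis_apply, monomialBasis_apply]
  change Matrix.vecMul (Pi.single i.1 (monomialD Δ A i.2)) (B.map (coeff Δ)) = _
  rw [Matrix.single_vecMul]
  rfl

end FreeBasis

/-! ### Second order coefficients of prolonged equations. -/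

section Symbol

open FirstOrderSystem DiffOp

variable {K : Type*} [Field K] {n m : ℕ} {Δ : CommDerivations K n} {A : Matrix (Fin n) (Fin n) K}

theorem monomialD_single (hc : ∀ l i j, Δ.der l (A i j) = 0) (i : Fin n) :
    monomialD Δ A (Pi.single i 1) = newD Δ A i := by
  have h := monomialD_add_single hc 0 i
  rwa [zero_add, monomialD_zero, mul_one] at h

theorem monomialD_single_add_single (hc : ∀ l i j, Δ.der l (A i j) = 0) (l i : Fin n) :
    monomialD Δ A (Pi.single i 1 + Pi.single l 1) = newD Δ A l * newD Δ A i := by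
  rw [monomialD_add_single hc, monomialD_single hc]

/-- The coefficient of `δ_p δ_q` in the `k`-th component. -/
noncomputable def quadCoeff (hA : IsUnit A.det) (hc : ∀ l i j, Δ.der l (A i j) = 0)
    (p q : Fin n) (k : Fin m) : (Fin m → DiffOp Δ) →ₗ[K] K :=
  (monomialBasis hA hc).coord (Pi.single p 1 + Pi.single q 1) ∘ₗ LinearMap.proj k

theorem single_add_single_eq_iff {i l p q : Fin n} :
    (Pi.single i 1 + Pi.single l 1 : Fin n → ℕ) = Pi.single p 1 + Pi.single q 1 ↔
      (i = p ∧ l = q) ∨ (i = q ∧ l = p) := by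
  constructor
  · intro h
    have hi := congrFun h i
    have hl := congrFun h l
    have hp := congrFun h p
    have hq := congrFun h q
    simp only [Pi.add_apply, Pi.single_apply] at hi hl hp hq
    grind
  · rintro (⟨rfl, rfl⟩ | ⟨rfl, rfl⟩)
    · rfl
    · exact add_comm _ _

variable (hA : IsUnit A.det) (hc : ∀ l i j, Δ.der l (A i j) = 0) (p q : Fin n) (k : Fin m)

theorem coord_monomialD (μ ν : Fin n → ℕ) :
    (monomialBasis hA hc).coord μ (monomialD Δ A ν) = if ν = μ then 1 else 0 := by
  rw [← monomialBasis_apply hA hc, Module.Basis.coord_apply, Module.Basis.repr_self,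
    Finsupp.single_apply]

theorem coord_newD (i : Fin n) :
    (monomialBasis hA hc).coord (Pi.single p 1 + Pi.single q 1) (newD Δ A i) = 0 := by
  rw [← monomialD_single hc, coord_monomialD, if_neg]
  intro h
  -- The two exponents have total degrees one and two.
  have h1 := congrArg (fun μ : Fin n → ℕ => ∑ j, μ j) h
  simp [Finset.sum_add_distrib] at h1

theorem coord_coeff (a : K) :
    (monomialBasis hA hc).coord (Pi.single p 1 + Pi.single q 1) (coeff Δ a) = 0 := by
  have h0 : coeff Δ a = a • monomialD Δ A 0 := by rw [monomialD_zero, smul_def, mul_one]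
  rw [h0, map_smul, coord_monomialD, if_neg, smul_zero]
  intro h
  have h1 := congrArg (fun μ : Fin n → ℕ => ∑ j, μ j) h
  simp [Finset.sum_add_distrib] at h1

theorem quadCoeff_jetForm (a : Fin n → Fin m → K) (b : Fin m → K) :
    quadCoeff hA hc p q k (jetForm Δ (newD Δ A) a b) = 0 := by
  rw [quadCoeff, LinearMap.comp_apply, LinearMap.proj_apply, jetForm, map_add, map_sum,
    coord_coeff, add_zero]
  refine Finset.sum_eq_zero fun i _ => ?_
  rw [map_smul, coord_newD, smul_zero]

/-- Moving `δ_l` past the coefficients creates only terms of order at most one, so the second order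
part is the commutative product of symbols. -/
theorem quadCoeff_smul_jetForm (l : Fin n) (a : Fin n → Fin m → K) (b : Fin m → K) :
    quadCoeff hA hc p q k (newD Δ A l • jetForm Δ (newD Δ A) a b) =
      ∑ i, if (i = p ∧ l = q) ∨ (i = q ∧ l = p) then a i k else 0 := by
  rw [quadCoeff, LinearMap.comp_apply, LinearMap.proj_apply, Pi.smul_apply, jetForm, smul_add,
    Finset.smul_sum, map_add, map_sum, smul_eq_mul, newD_mul_coeff hc, ← smul_def, map_add,
    map_smul, coord_newD, coord_coeff, smul_zero, add_zero, add_zero]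
  refine Finset.sum_congr rfl fun i _ => ?_
  rw [newD_smul_smul hc, smul_eq_mul (newD Δ A l), map_add, map_smul, map_smul, coord_newD,
    smul_zero, add_zero, ← monomialD_single_add_single hc, coord_monomialD]
  simp [single_add_single_eq_iff]

end Symbol

/-! ### The flag of leading spaces of an involutive solved form. -/

namespace FirstOrderSystem.SolvedForm

open DiffOp

variable {K : Type*} [Field K] {n m : ℕ} {Δ : CommDerivations K n} {S : FirstOrderSystem K n m}
  (F : S.SolvedForm Δ)

/-- The space spanned by the leading rows of the equations of class `i`. -/
def leadSpace (i : Fin n) : Submodule K (Fin m → K) :=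
  Submodule.span K (Set.range fun τ : {τ : Fin F.q // F.cls τ = i.succ} => F.a τ.1 i)

theorem finrank_leadSpace (i : Fin n) : Module.finrank K (F.leadSpace i) = F.β i.succ := by
  rw [leadSpace, finrank_span_eq_card (F.solved i), Fintype.card_subtype, β]

/-- An equation of class `0` has order zero, hence vanishes by `NoZeroOrder`, against the
independence of these equations. -/
theorem exists_cls_eq_succ (h0 : S.NoZeroOrder Δ) (τ : Fin F.q) :
    ∃ i : Fin n, F.cls τ = i.succ := by
  refine Fin.exists_succ_eq.2 (fun h => ?_) |>.imp fun _ h => h.symm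
  refine F.solved_zero.ne_zero ⟨τ, h⟩ (h0 _ ?_)
  rw [← F.span_eq]
  refine Submodule.subset_span ⟨τ, funext fun k => ?_⟩
  have : ∀ i k, F.a τ i k = 0 := fun i k => F.cls_le τ i k (by simp [h])
  simp [jetForm, zeroForm, this]

variable {F}

/-- The second order part of the involution condition; the equations that are not differentiated do
not contribute to it. -/
theorem IsInvolutive.exists_symbol_relation (hF : F.IsInvolutive) (τ : Fin F.q) (j : Fin n) :
    ∃ γ : Fin F.q → Fin n → K, (∀ σ (l : Fin n), (F.cls σ : ℕ) ≤ l → γ σ l = 0) ∧ ∀ p q k,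
      (∑ i, if (i = p ∧ j = q) ∨ (i = q ∧ j = p) then F.a τ i k else 0) =
        ∑ σ, ∑ l, γ σ l * ∑ i, if (i = p ∧ l = q) ∨ (i = q ∧ l = p) then F.a σ i k else 0 := by
  have key : ∀ v ∈ Submodule.span K (Set.range F.eqn ∪
      {v | ∃ (σ : Fin F.q) (l : Fin n), (l : ℕ) < F.cls σ ∧ v = F.δ l • F.eqn σ}),
      ∃ γ : Fin F.q → Fin n → K, (∀ σ (l : Fin n), (F.cls σ : ℕ) ≤ l → γ σ l = 0) ∧ ∀ p q k,
      quadCoeff F.A_unit F.A_const p q k v =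
        ∑ σ, ∑ l, γ σ l * ∑ i, if (i = p ∧ l = q) ∨ (i = q ∧ l = p) then F.a σ i k else 0 := by
    intro v hv
    induction hv using Submodule.span_induction with
    | mem v hv =>
      rcases hv with ⟨σ, rfl⟩ | ⟨σ, l, hl, rfl⟩
      · refine ⟨0, fun _ _ _ => rfl, fun p q k => ?_⟩
        rw [eqn]
        refine (quadCoeff_jetForm F.A_unit F.A_const p q k _ _).trans ?_
        simp
      · refine ⟨Pi.single σ (Pi.single l 1), fun σ' l' h => ?_, fun p q k => ?_⟩
        · rcases eq_or_ne σ' σ with rfl | hσ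
          · rcases eq_or_ne l' l with rfl | hl'
            · omega
            · simp [hl']
          · simp [hσ]
        · refine (quadCoeff_smul_jetForm F.A_unit F.A_const p q k l _ _).trans (Eq.symm ?_)
          rw [Finset.sum_eq_single σ, Finset.sum_eq_single l]
          · simp
          · intro l' _ hl'
            simp [hl']
          · simp
          · intro σ' _ hσ
            simp [hσ]
          · simp
    | zero => exact ⟨0, fun _ _ _ => rfl, fun p q k => by simp⟩
    | add x y _ _ hx hy =>
      obtain ⟨γ, hγ, h⟩ := hx
      obtain ⟨γ', hγ', h'⟩ := hy
      refine ⟨γ + γ', fun σ l hl => ?_, fun p q k => ?_⟩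
      · simp [hγ σ l hl, hγ' σ l hl]
      · rw [map_add, h, h']
        simp only [Pi.add_apply, add_mul, Finset.sum_add_distrib]
    | smul a x _ hx =>
      obtain ⟨γ, hγ, h⟩ := hx
      refine ⟨a • γ, fun σ l hl => ?_, fun p q k => ?_⟩
      · simp [hγ σ l hl]
      · rw [map_smul, h]
        simp only [Pi.smul_apply, smul_eq_mul, mul_assoc, Finset.mul_sum]
  obtain ⟨γ, hγ, h⟩ := key _ (hF τ j)
  exact ⟨γ, hγ, fun p q k =>
    (quadCoeff_smul_jetForm F.A_unit F.A_const p q k j _ _).symm.trans (h p q k)⟩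

/-- A relation between the leading rows of the equations of class `e` has zero coefficients. -/
theorem eq_zero_of_sum_lead_eq_zero (e : Fin n) (γ : Fin F.q → K)
    (hlow : ∀ σ, e.succ < F.cls σ → γ σ = 0) (h : ∑ σ, γ σ • F.a σ e = 0) (σ : Fin F.q)
    (hσ : F.cls σ = e.succ) : γ σ = 0 := by
  have hli := Fintype.linearIndependent_iff.1 (F.solved e) (fun σ => γ σ.1) ?_ ⟨σ, hσ⟩
  · exact hli
  · rw [← h]
    refine Finset.sum_bij_ne_zero (fun σ _ _ => σ.1) (fun _ _ _ => Finset.mem_univ _)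
      (fun _ _ _ _ _ _ h => Subtype.ext h) ?_ (fun _ _ _ => rfl)
    intro σ _ hne
    refine ⟨⟨σ, ?_⟩, Finset.mem_univ _, hne, rfl⟩
    rcases lt_trichotomy (F.cls σ) e.succ with hlt | heq | hgt
    · refine (hne ?_).elim
      have : F.a σ e = 0 := funext fun k => F.cls_le σ e k (by
        have := Fin.lt_def.1 hlt
        simp only [Fin.val_succ] at this
        omega)
      rw [this, smul_zero]
    · exact heq
    · exact (hne (by rw [hlow σ hgt, zero_smul])).elim

/-- The nonmultiplicative derivative `δ_j Ψ^τ` is compared with its multiplicative expression.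
Descending elimination removes from that expression all equations of class above that of `j`; the
coefficient of `δ_j δ_c` then exhibits the row as a combination of leading rows of the class of `j`.
-/
theorem IsInvolutive.row_mem_leadSpace (hF : F.IsInvolutive) {c j : Fin n} (hcj : c < j)
    {τ : Fin F.q} (hτ : F.cls τ = c.succ) : F.a τ c ∈ F.leadSpace j := by
  obtain ⟨γ, hγ, h⟩ := hF.exists_symbol_relation τ j
  have hτ0 : ∀ e : Fin n, c < e → F.a τ e = 0 := fun e he => funext fun k =>
    F.cls_le τ e k (by rw [hτ]; simpa using he)
  have hdiag : ∀ p : Fin n, (if j = p then F.a τ p else 0) = ∑ σ, γ σ p • F.a σ p := by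
    intro p
    funext k
    have := h p p k
    simp only [or_self, ite_and, Finset.sum_ite_eq', Finset.mem_univ, if_true] at this
    rw [Finset.sum_apply]
    simp only [Pi.smul_apply, smul_eq_mul]
    convert this using 1
    · split <;> simp
    · simp
  have hoff : ∀ p q : Fin n, p ≠ q →
      (if j = q then F.a τ p else 0) + (if j = p then F.a τ q else 0) =
        ∑ σ, (γ σ q • F.a σ p + γ σ p • F.a σ q) := by
    intro p q hpq
    funext k
    have hsum : ∀ (σ : Fin n → Fin m → K) (l : Fin n),
        (∑ i, if (i = p ∧ l = q) ∨ (i = q ∧ l = p) then σ i k else 0) =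
          (if l = q then σ p k else 0) + (if l = p then σ q k else 0) := by
      intro σ l
      have : ∀ i, (if (i = p ∧ l = q) ∨ (i = q ∧ l = p) then σ i k else 0) =
          (if i = p then if l = q then σ i k else 0 else 0) +
            (if i = q then if l = p then σ i k else 0 else 0) := by
        intro i
        grind
      simp only [this, Finset.sum_add_distrib, Finset.sum_ite_eq', Finset.mem_univ, if_true]
    have := h p q k
    simp only [hsum] at this
    rw [Finset.sum_apply]
    simp only [Pi.add_apply, Pi.smul_apply, smul_eq_mul]
    convert this using 1
    · congr 1 <;> split <;> simp
    · simp [mul_add, Finset.sum_add_distrib]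
  -- Descending induction on `e ≥ j`: the coefficient of `δ_e δ_e` shows that the multiplier `δ_e`
  -- does not occur, and then that of `δ_e δ_l`, for `e > j`, that equations of the class of `e` do
  -- not occur.
  have hγ0 : ∀ r : ℕ, ∀ e : Fin n, (e : ℕ) + r = n → j ≤ e →
      (∀ σ, γ σ e = 0) ∧ (j < e → ∀ σ, F.cls σ = e.succ → ∀ l, γ σ l = 0) := by
    intro r
    induction r using Nat.strong_induction_on with
    | _ r ih =>
      intro e her hje
      have hhigh : ∀ σ, e.succ < F.cls σ → ∀ l, γ σ l = 0 := by
        intro σ hσ l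
        obtain ⟨e', he'⟩ := Fin.exists_succ_eq.2 (Fin.ne_zero_of_lt hσ)
        rw [← he', Fin.succ_lt_succ_iff] at hσ
        have := Fin.lt_def.1 hσ
        exact (ih (n - e') (by omega) e' (by omega) (hje.trans hσ.le)).2 (hje.trans_lt hσ) σ
          he'.symm l
      have hrow : (if j = e then F.a τ e else 0) = 0 := by
        split
        · exact hτ0 e (hcj.trans_le hje)
        · rfl
      have h1 : ∀ σ, γ σ e = 0 := by
        intro σ
        rcases lt_trichotomy (F.cls σ) e.succ with hlt | heq | hgt
        · refine hγ σ e ?_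
          have := Fin.lt_def.1 hlt
          simp only [Fin.val_succ] at this
          omega
        · exact eq_zero_of_sum_lead_eq_zero e (fun σ => γ σ e) (fun σ hσ => hhigh σ hσ e)
            ((hdiag e).symm.trans hrow) σ heq
        · exact hhigh σ hgt e
      refine ⟨h1, fun hlt σ hσ l => ?_⟩
      rcases lt_trichotomy e l with hel | rfl | hel
      · refine hγ σ l ?_
        rw [hσ]
        simpa using hel
      · exact h1 σ
      · have h2 := hoff e l hel.ne'
        simp only [h1, zero_smul, add_zero, hlt.ne, if_false, hτ0 e (hcj.trans hlt), ite_self]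
          at h2
        exact eq_zero_of_sum_lead_eq_zero e (fun σ => γ σ l) (fun σ hσ => hhigh σ hσ l) h2.symm
          σ hσ
  have hjγ := (hγ0 (n - j) j (by omega) le_rfl).1
  -- The coefficient of `δ_j δ_c`, now that no `δ_j` occurs as a multiplier.
  have h3 := hoff j c hcj.ne'
  simp only [hjγ, zero_smul, add_zero, if_true, hcj.ne', if_false, zero_add] at h3
  rw [h3]
  refine Submodule.sum_mem _ fun σ _ => ?_
  rcases lt_trichotomy (F.cls σ) j.succ with hlt | heq | hgt
  · have : F.a σ j = 0 := funext fun k => F.cls_le σ j k (by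
      have := Fin.lt_def.1 hlt
      simp only [Fin.val_succ] at this
      omega)
    rw [this, smul_zero]
    exact Submodule.zero_mem _
  · exact Submodule.smul_mem _ _ (Submodule.subset_span ⟨⟨σ, heq⟩, rfl⟩)
  · obtain ⟨e, he⟩ := Fin.exists_succ_eq.2 (Fin.ne_zero_of_lt hgt)
    rw [← he, Fin.succ_lt_succ_iff] at hgt
    have := (hγ0 (n - e) e (by omega) hgt.le).2 hgt σ he.symm c
    rw [this, zero_smul]
    exact Submodule.zero_mem _

theorem IsInvolutive.leadSpace_mono (hF : F.IsInvolutive) : Monotone F.leadSpace := by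
  intro c j hcj
  rcases hcj.eq_or_lt with rfl | hlt
  · exact le_rfl
  · refine Submodule.span_le.2 ?_
    rintro _ ⟨τ, rfl⟩
    exact hF.row_mem_leadSpace hlt τ.2

/-- As `β` increases along the flag, the indices counted by `type` form an initial segment. In
zero-based indexing its cardinality is at most `c` exactly when `c` lies outside it. -/
theorem IsInvolutive.type_le_iff (hF : F.IsInvolutive) (k : Fin m) (c : Fin n) :
    F.type k ≤ c ↔ (k : ℕ) < F.β c.succ := by
  have hmono : ∀ i j : Fin n, i ≤ j → F.β i.succ ≤ F.β j.succ := by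
    intro i j hij
    rw [← finrank_leadSpace, ← finrank_leadSpace]
    exact Submodule.finrank_mono (hF.leadSpace_mono hij)
  rw [type]
  constructor
  · intro h
    by_contra! hk
    have : Finset.univ.filter (fun i : Fin n => i ≤ c) ⊆
        Finset.univ.filter (fun i : Fin n => F.β i.succ ≤ k) := by
      intro i hi
      rw [Finset.mem_filter] at hi ⊢
      exact ⟨hi.1, (hmono i c hi.2).trans hk⟩
    have := Finset.card_le_card this
    rw [show Finset.univ.filter (fun i : Fin n => i ≤ c) = Finset.Iic c by ext; simp,
      Fin.card_Iic] at this
    omega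
  · intro h
    have : Finset.univ.filter (fun i : Fin n => F.β i.succ ≤ k) ⊆ Finset.Iio c := by
      intro i hi
      rw [Finset.mem_filter] at hi
      rw [Finset.mem_Iio]
      by_contra! hci
      have := hmono c i hci
      omega
    have := Finset.card_le_card this
    rwa [Fin.card_Iio] at this

theorem IsInvolutive.exists_adapted (hF : F.IsInvolutive) :
    ∃ B : Matrix (Fin m) (Fin m) K, IsUnit B.det ∧
      ∀ i, F.leadSpace i = Submodule.span K (B '' {k | (k : ℕ) < F.β i.succ}) := by
  obtain ⟨b, hb, h⟩ := exists_basis_adapted_flag (m := m) (by simp) F.leadSpace hF.leadSpace_mono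
  refine ⟨b, ?_, fun i => ?_⟩
  · exact (Matrix.isUnit_iff_isUnit_det _).1
      (Matrix.linearIndependent_rows_iff_isUnit (A := Matrix.of b).1 hb)
  · rw [← finrank_leadSpace]
    exact h i

end FirstOrderSystem.SolvedForm

/-! ### Monomial operators, coefficients and weight. -/

section Monomials

open FirstOrderSystem DiffOp

variable {K : Type*} [Field K] {n m : ℕ} {Δ : CommDerivations K n} {A : Matrix (Fin n) (Fin n) K}

theorem monomialD_add (hc : ∀ l i j, Δ.der l (A i j) = 0) (μ ν : Fin n → ℕ) :
    monomialD Δ A (μ + ν) = monomialD Δ A μ * monomialD Δ A ν := by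
  induction μ using exponent_induction with
  | zero => rw [zero_add, monomialD_zero, one_mul]
  | add μ j ih =>
    rw [add_right_comm, monomialD_add_single hc, ih, monomialD_add_single hc, mul_assoc]

theorem monomialD_smul_newD_smul {N : Type*} [AddCommGroup N] [Module (DiffOp Δ) N]
    (hc : ∀ l i j, Δ.der l (A i j) = 0) (μ : Fin n → ℕ) (l : Fin n) (x : N) :
    monomialD Δ A μ • newD Δ A l • x = monomialD Δ A (μ + Pi.single l 1) • x := by
  rw [monomialD_add hc, monomialD_single hc, mul_smul]

variable {N : Type*} [AddCommGroup N] [Module (DiffOp Δ) N] [Module K N]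
  [IsScalarTower K (DiffOp Δ) N]

theorem monomialD_smul_smul_mem (hc : ∀ l i j, Δ.der l (A i j) = 0) (μ : Fin n → ℕ) (a : K)
    (x : N) :
    monomialD Δ A μ • a • x ∈ Submodule.span K {y | ∃ κ ≤ μ, y = monomialD Δ A κ • x} := by
  induction μ using exponent_induction with
  | zero =>
    rw [monomialD_zero, one_smul]
    refine Submodule.smul_mem _ _ (Submodule.subset_span ⟨0, le_rfl, ?_⟩)
    rw [monomialD_zero, one_smul]
  | add μ j ih =>
    rw [monomialD_add_single hc, mul_smul]
    refine span_newD_smul_le hc j ?_ ?_ ih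
    · rintro _ ⟨κ, hκ, rfl⟩
      exact Submodule.subset_span ⟨κ, hκ.trans le_self_add, rfl⟩
    · rintro _ ⟨κ, hκ, rfl⟩
      refine Submodule.subset_span ⟨κ + Pi.single j 1, add_le_add_left hκ _, ?_⟩
      rw [monomialD_add_single hc, mul_smul]

/-- Moving coefficients to the left of `δ^μ` produces divisors of `δ^μ`, so all `κ ≤ μ` must be
controlled. -/
theorem monomialD_smul_mem_of_span (hc : ∀ l i j, Δ.der l (A i j) = 0) {μ : Fin n → ℕ} {s : Set N}
    {W : Submodule K N} (h : ∀ y ∈ s, ∀ κ ≤ μ, monomialD Δ A κ • y ∈ W) {x : N}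
    (hx : x ∈ Submodule.span K s) : monomialD Δ A μ • x ∈ W := by
  suffices ∀ κ ≤ μ, monomialD Δ A κ • x ∈ W from this μ le_rfl
  induction hx using Submodule.span_induction with
  | mem x hx => exact h x hx
  | zero =>
    intro κ _
    rw [smul_zero]
    exact W.zero_mem
  | add x y _ _ hx hy =>
    intro κ hκ
    rw [smul_add]
    exact W.add_mem (hx κ hκ) (hy κ hκ)
  | smul a x _ hx =>
    intro κ hκ
    refine Submodule.span_le.2 ?_ (monomialD_smul_smul_mem hc κ a x)
    rintro _ ⟨κ', hκ', rfl⟩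
    exact hx κ' (hκ'.trans hκ)

/-- The forms of weight less than `r`. -/
noncomputable def weightLT (Δ : CommDerivations K n) (A : Matrix (Fin n) (Fin n) K) (m r : ℕ) :
    Submodule K (Fin m → DiffOp Δ) :=
  Submodule.span K {x | ∃ (κ : Fin n → ℕ) (s : Fin m → K), weight κ < r ∧
    x = monomialD Δ A κ • zeroForm Δ s}

theorem monomialD_smul_mem_weightLT (hc : ∀ l i j, Δ.der l (A i j) = 0) (μ : Fin n → ℕ) {r : ℕ}
    {x : Fin m → DiffOp Δ} (hx : x ∈ weightLT Δ A m r) :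
    monomialD Δ A μ • x ∈ weightLT Δ A m (weight μ + r) := by
  refine monomialD_smul_mem_of_span hc ?_ hx
  rintro _ ⟨κ, s, hκ, rfl⟩ κ' hκ'
  refine Submodule.subset_span ⟨κ' + κ, s, ?_, ?_⟩
  · rw [weight_add]
    exact add_lt_add_of_le_of_lt (weight_mono hκ') hκ
  · rw [monomialD_add hc, mul_smul]

theorem weightLT_le_span_jets (hc : ∀ l i j, Δ.der l (A i j) = 0)
    {B : Matrix (Fin m) (Fin m) K} (hB : IsUnit B.det) (r : ℕ) :
    weightLT Δ A m r ≤ Submodule.span K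
      {x | ∃ (κ : Fin n → ℕ) (k : Fin m), weight κ < r ∧
        x = monomialD Δ A κ • zeroForm Δ (B k)} := by
  refine Submodule.span_le.2 ?_
  rintro _ ⟨κ, s, hκ, rfl⟩
  have hs : zeroForm Δ s ∈ Submodule.span K (Set.range fun k => zeroForm Δ (B k)) := by
    have h1 : s = ∑ k, Matrix.vecMul s B⁻¹ k • B k := by
      rw [← Matrix.vecMul_eq_sum, Matrix.vecMul_vecMul, Matrix.nonsing_inv_mul B hB,
        Matrix.vecMul_one]
    rw [h1, ← zeroFormHom_apply, map_sum]
    refine Submodule.sum_mem _ fun k _ => ?_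
    rw [map_smul]
    exact Submodule.smul_mem _ _ (Submodule.subset_span ⟨k, rfl⟩)
  refine monomialD_smul_mem_of_span hc ?_ hs
  rintro _ ⟨k, rfl⟩ κ' hκ'
  exact Submodule.subset_span ⟨κ', k, (weight_mono hκ').trans_lt hκ, rfl⟩

theorem jetForm_eq_sum_newD_smul (hc : ∀ l i j, Δ.der l (A i j) = 0) (a : Fin n → Fin m → K)
    (b : Fin m → K) :
    jetForm Δ (newD Δ A) a b = (∑ i, newD Δ A i • zeroForm Δ (a i)) +
      zeroForm Δ (fun k => b k - ∑ i, (Δ.change A hc).der i (a i k)) := by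
  funext k
  simp only [jetForm, zeroForm, Pi.add_apply, Finset.sum_apply, Pi.smul_apply, smul_eq_mul,
    newD_mul_coeff hc, Finset.sum_add_distrib, map_sub, map_sum, smul_def]
  abel

theorem exists_last_ne_zero {μ : Fin n → ℕ} {t : ℕ} (h : ¬∀ j : Fin n, t ≤ j → μ j = 0) :
    ∃ (c : Fin n) (ν : Fin n → ℕ), t ≤ c ∧ μ = ν + Pi.single c 1 ∧ ∀ j, c < j → ν j = 0 := by
  push Not at h
  -- Any index beyond one that is at least `t` is itself at least `t`, so this maximal `c` is the
  -- last variable of the whole monomial.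
  obtain ⟨c, ⟨hct, hc⟩, hmax⟩ := Set.Finite.exists_maximal
    (Set.toFinite {j : Fin n | t ≤ j ∧ μ j ≠ 0}) h
  have hle : Pi.single c 1 ≤ μ := by
    intro l
    rcases eq_or_ne l c with rfl | hl
    · simpa using Nat.one_le_iff_ne_zero.2 hc
    · simp [hl]
  refine ⟨c, μ - Pi.single c 1, hct, (tsub_add_cancel_of_le hle).symm, fun j hj => ?_⟩
  have : μ j = 0 := by
    by_contra hne
    exact absurd (hmax ⟨hct.trans (Fin.le_def.1 hj.le), hne⟩ hj.le) (not_le.2 hj)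
  simp [this]

end Monomials

/-! ### Multiplicative derivatives of the equations and prescribed leading rows. -/

namespace FirstOrderSystem.SolvedForm

open DiffOp

variable {K : Type*} [Field K] {n m : ℕ} {Δ : CommDerivations K n} {S : FirstOrderSystem K n m}
  (F : S.SolvedForm Δ)

/-- The span of the derivatives of the equations with respect to multiplicative variables. -/
noncomputable def multSpan : Submodule K (Fin m → DiffOp Δ) :=
  Submodule.span K {x | ∃ (μ : Fin n → ℕ) (σ : Fin F.q),
    (∀ j : Fin n, (F.cls σ : ℕ) ≤ j → μ j = 0) ∧ x = monomialD Δ F.A μ • F.eqn σ}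

variable {F}

/-- Induction on the weight. When the last variable of `δ^ν` is nonmultiplicative, apply it first
and rewrite the result by involutivity. -/
theorem IsInvolutive.monomialD_smul_eqn_mem (hF : F.IsInvolutive) (ν : Fin n → ℕ) (σ : Fin F.q) :
    monomialD Δ F.A ν • F.eqn σ ∈ F.multSpan := by
  induction hw : weight ν using Nat.strong_induction_on generalizing ν σ with
  | _ w ih =>
    by_cases hm : ∀ j : Fin n, (F.cls σ : ℕ) ≤ j → ν j = 0
    · exact Submodule.subset_span ⟨ν, σ, hm, rfl⟩
    · obtain ⟨j, ν, hj, rfl, hν⟩ := exists_last_ne_zero hm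
      rw [weight_add, weight_single] at hw
      rw [← monomialD_smul_newD_smul F.A_const]
      refine monomialD_smul_mem_of_span F.A_const ?_ (hF σ j)
      rintro _ (⟨σ', rfl⟩ | ⟨σ', l, hl, rfl⟩) κ hκ
      · exact ih (weight κ) (by have := weight_mono hκ; omega) κ σ' rfl
      · change monomialD Δ F.A κ • newD Δ F.A l • F.eqn σ' ∈ _
        rw [monomialD_smul_newD_smul F.A_const]
        -- If `j` is multiplicative for the new equation, so is all of `κ`, whose variables go up to
        -- `j`. Otherwise `l` precedes `j` and the weight drops.
        by_cases hjσ : (j : ℕ) < F.cls σ'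
        · refine Submodule.subset_span ⟨_, σ', fun i hi => ?_, rfl⟩
          have h1 : κ i ≤ ν i := hκ i
          have h2 : ν i = 0 := hν i (Fin.lt_def.2 (by omega))
          have h3 : i ≠ l := by
            rintro rfl
            omega
          simp [h3]
          omega
        · refine ih (weight (κ + Pi.single l 1)) ?_ _ σ' rfl
          have := weight_mono hκ
          rw [weight_add, weight_single]
          omega

theorem IsInvolutive.eqModule_le (hF : F.IsInvolutive) :
    (S.eqModule Δ).restrictScalars K ≤ F.multSpan := by
  have hstable : ∀ i, ∀ x ∈ F.multSpan, newD Δ F.A i • x ∈ F.multSpan := by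
    intro i x hx
    refine span_newD_smul_le F.A_const i Submodule.subset_span ?_ hx
    rintro _ ⟨μ, σ, -, rfl⟩
    rw [← mul_smul, ← monomialD_add_single F.A_const]
    exact hF.monomialD_smul_eqn_mem _ σ
  intro x hx
  rw [Submodule.restrictScalars_mem, eqModule] at hx
  induction hx using Submodule.span_induction with
  | mem x hx =>
    have h1 : x ∈ S.eqSpace Δ := Submodule.subset_span hx
    rw [← F.span_eq] at h1
    refine Submodule.span_le.2 ?_ h1
    rintro _ ⟨σ, rfl⟩
    have := hF.monomialD_smul_eqn_mem 0 σ
    rwa [monomialD_zero, one_smul] at this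
  | zero => exact Submodule.zero_mem _
  | add x y _ _ hx hy => exact Submodule.add_mem _ hx hy
  | smul P x _ hx => exact newD_induction F.A_unit hstable P hx

theorem eqn_mem_eqModule (σ : Fin F.q) : F.eqn σ ∈ S.eqModule Δ := by
  have h1 : F.eqn σ ∈ S.eqSpace Δ := by
    rw [← F.span_eq]
    exact Submodule.subset_span ⟨σ, rfl⟩
  have h2 : S.eqSpace Δ ≤ (S.eqModule Δ).restrictScalars K :=
    Submodule.span_le.2 Submodule.subset_span
  exact h2 h1

variable (F) in
/-- The equation of class `i` with a given leading row. -/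
theorem exists_leadLift (i : Fin n) : ∃ L : (Fin m → K) →ₗ[K] (Fin m → DiffOp Δ),
    ∀ τ, F.cls τ = i.succ → L (F.a τ i) = F.eqn τ := by
  -- Independence of the leading rows defines the lift on `leadSpace i`; its values elsewhere are
  -- immaterial.
  obtain ⟨L, hL⟩ := LinearMap.exists_extend
    (Finsupp.linearCombination K (fun τ : {τ : Fin F.q // F.cls τ = i.succ} => F.eqn τ.1) ∘ₗ
      (F.solved i).repr)
  refine ⟨L, fun τ hτ => ?_⟩
  have hmem : F.a τ i ∈ Submodule.span K
      (Set.range fun τ : {τ : Fin F.q // F.cls τ = i.succ} => F.a τ.1 i) :=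
    Submodule.subset_span ⟨⟨τ, hτ⟩, rfl⟩
  have h := LinearMap.congr_fun hL ⟨_, hmem⟩
  rw [LinearMap.comp_apply, LinearMap.comp_apply] at h
  refine h.trans ?_
  rw [(F.solved i).repr_eq_single ⟨τ, hτ⟩ ⟨_, hmem⟩ rfl,
    Finsupp.linearCombination_single, one_smul]

variable {i : Fin n} {L : (Fin m → K) →ₗ[K] (Fin m → DiffOp Δ)}

theorem leadLift_mem_eqModule
    (hL : ∀ τ, F.cls τ = i.succ → L (F.a τ i) = F.eqn τ) {r : Fin m → K} (hr : r ∈ F.leadSpace i) :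
    L r ∈ S.eqModule Δ := by
  have : F.leadSpace i ≤ ((S.eqModule Δ).restrictScalars K).comap L := by
    refine Submodule.span_le.2 ?_
    rintro _ ⟨τ, rfl⟩
    change L (F.a τ.1 i) ∈ S.eqModule Δ
    rw [hL τ.1 τ.2]
    exact eqn_mem_eqModule τ.1
  exact this hr

theorem leadLift_sub_mem
    (hL : ∀ τ, F.cls τ = i.succ → L (F.a τ i) = F.eqn τ) {r : Fin m → K} (hr : r ∈ F.leadSpace i) :
    L r - newD Δ F.A i • zeroForm Δ r ∈ weightLT Δ F.A m ((i : ℕ) + 1) := by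
  have hz : ∀ s : Fin m → K, zeroForm Δ s ∈ weightLT Δ F.A m ((i : ℕ) + 1) := fun s =>
    Submodule.subset_span ⟨0, s, by simp [weight], by rw [monomialD_zero, one_smul]⟩
  rw [leadSpace] at hr
  induction hr using Submodule.span_induction with
  | mem x hx =>
    obtain ⟨τ, rfl⟩ := hx
    simp only
    rw [hL τ.1 τ.2, eqn]
    change jetForm Δ (newD Δ F.A) (F.a τ.1) (F.b τ.1) - _ ∈ _
    rw [jetForm_eq_sum_newD_smul F.A_const, add_sub_right_comm,
      ← Finset.add_sum_erase _ _ (Finset.mem_univ i), add_sub_cancel_left]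
    refine Submodule.add_mem _ (Submodule.sum_mem _ fun j hj => ?_) (hz _)
    -- Variables before `i` weigh less than `i`; those after it are absent from an equation of this
    -- class.
    rcases lt_or_gt_of_ne (Finset.ne_of_mem_erase hj) with hlt | hgt
    · refine Submodule.subset_span ⟨Pi.single j 1, F.a τ.1 j, ?_, ?_⟩
      · rw [weight_single]
        have := Fin.lt_def.1 hlt
        omega
      · rw [monomialD_single F.A_const]
    · have h0 : F.a τ.1 j = 0 := funext fun k => F.cls_le τ.1 j k (by
        rw [τ.2]
        simpa using hgt)
      rw [h0, ← zeroFormHom_apply, map_zero, smul_zero]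
      exact Submodule.zero_mem _
  | zero => simp [← zeroFormHom_apply]
  | add x y _ _ hx hy =>
    rw [map_add, zeroForm_add, smul_add, add_sub_add_comm]
    exact Submodule.add_mem _ hx hy
  | smul a x _ hx =>
    rw [map_smul, zeroForm_smul, newD_smul_smul F.A_const, ← sub_sub, ← smul_sub]
    exact Submodule.sub_mem _ (Submodule.smul_mem _ _ hx) (Submodule.smul_mem _ _ (hz x))

end FirstOrderSystem.SolvedForm

/-! ### Parametric jets as a basis of the differential module. -/

namespace FirstOrderSystem.SolvedForm

open DiffOp

variable {K : Type*} [Field K] {n m : ℕ} {Δ : CommDerivations K n} {S : FirstOrderSystem K n m}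
  {F : S.SolvedForm Δ}

/-- The exponents that are not those of a parametric jet. -/
def principal (F : S.SolvedForm Δ) : Set (Σ _ : Fin m, (Fin n → ℕ)) :=
  {i | ¬∀ j : Fin n, F.type i.1 ≤ j → i.2 j = 0}

theorem not_mem_principal {i : Σ _ : Fin m, (Fin n → ℕ)} :
    i ∉ F.principal ↔ ∀ j : Fin n, F.type i.1 ≤ j → i.2 j = 0 := not_not

theorem add_single_mem_principal {k : Fin m} {c : Fin n} (h : F.type k ≤ c) (ν : Fin n → ℕ) :
    (⟨k, ν + Pi.single c 1⟩ : Σ _ : Fin m, (Fin n → ℕ)) ∈ F.principal := fun hall => by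
  simpa using hall c h

/-- Parametric jets, completed to a basis of `D^m` by derivatives of the equations. -/
theorem IsInvolutive.exists_basis_equations (hF : F.IsInvolutive) (h0 : S.NoZeroOrder Δ)
    {B : Matrix (Fin m) (Fin m) K} (hB : IsUnit B.det)
    (hBF : ∀ i, F.leadSpace i = Submodule.span K (B '' {k | (k : ℕ) < F.β i.succ})) :
    ∃ b : Module.Basis (Σ _ : Fin m, (Fin n → ℕ)) K (Fin m → DiffOp Δ),
      (∀ i ∉ F.principal, b i = monomialD Δ F.A i.2 • zeroForm Δ (B i.1)) ∧
      (∀ i ∈ F.principal, b i ∈ S.eqModule Δ) ∧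
      (S.eqModule Δ).restrictScalars K ≤ Submodule.span K (b '' F.principal) := by
  choose L hL using F.exists_leadLift
  have hBmem : ∀ (k : Fin m) (c : Fin n), F.type k ≤ c → B k ∈ F.leadSpace c := by
    intro k c h
    rw [hBF c]
    exact Submodule.subset_span ⟨k, (hF.type_le_iff k c).1 h, rfl⟩
  have hg : ∀ i : Σ _ : Fin m, (Fin n → ℕ), ∃ x : Fin m → DiffOp Δ,
      (i ∉ F.principal → x = monomialD Δ F.A i.2 • zeroForm Δ (B i.1)) ∧
      (∀ (c : Fin n) (ν : Fin n → ℕ), F.type i.1 ≤ c → (∀ j, c < j → ν j = 0) →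
        i.2 = ν + Pi.single c 1 → x = monomialD Δ F.A ν • L c (B i.1)) := by
    rintro ⟨k, μ⟩
    by_cases h : (⟨k, μ⟩ : Σ _ : Fin m, (Fin n → ℕ)) ∈ F.principal
    · obtain ⟨c, ν, hc, hμ, hν⟩ := exists_last_ne_zero h
      refine ⟨monomialD Δ F.A ν • L c (B k), fun h' => (h' h).elim, fun c' ν' hc' hν' hμ' => ?_⟩
      · have heq : ν + Pi.single c 1 = ν' + Pi.single c' 1 := hμ.symm.trans hμ'
        have hcc : c = c' := by
          rcases lt_trichotomy c c' with hlt | heq' | hgt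
          · have := congrFun heq c'
            simp [hν c' hlt, hlt.ne'] at this
          · exact heq'
          · have := congrFun heq c
            simp [hν' c hgt, hgt.ne'] at this
        subst hcc
        rw [add_right_cancel heq]
    · refine ⟨_, fun _ => rfl, fun c ν hc _ hμ => (h ?_).elim⟩
      have := add_single_mem_principal (F := F) hc ν
      simp only at hμ
      rwa [← hμ] at this
  choose g hg1 hg2 using hg
  let e := jetBasis F.A_unit F.A_const hB
  -- A principal jet `δ^ν δ_c z^k` is replaced by `δ^ν` of the equation with leading term `δ_c z^k`,
  -- which changes it only in lower weight.
  obtain ⟨b, hb⟩ := e.exists_of_unitriangular (fun i => weight i.2) g (by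
    rintro ⟨k, μ⟩
    by_cases h : (⟨k, μ⟩ : Σ _ : Fin m, (Fin n → ℕ)) ∈ F.principal
    · obtain ⟨c, ν, hc, hμ, hν⟩ := exists_last_ne_zero h
      simp only at hμ hc
      subst hμ
      rw [hg2 _ c ν hc hν rfl, jetBasis_apply]
      simp only
      rw [← monomialD_smul_newD_smul F.A_const, ← smul_sub]
      have h1 := monomialD_smul_mem_weightLT F.A_const ν (leadLift_sub_mem (hL c) (hBmem k c hc))
      refine Submodule.span_mono ?_ (weightLT_le_span_jets F.A_const hB _ h1)
      rintro _ ⟨κ, l, hκ, rfl⟩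
      refine ⟨⟨l, κ⟩, ?_, jetBasis_apply _ _ _ _⟩
      rw [Set.mem_ofPred_eq, weight_add, weight_single]
      exact hκ
    · rw [hg1 _ h, jetBasis_apply, sub_self]
      exact Submodule.zero_mem _)
  refine ⟨b, fun i hi => by rw [hb, hg1 i hi], fun i hi => ?_, ?_⟩
  · obtain ⟨c, ν, hc, hμ, hν⟩ := exists_last_ne_zero hi
    rw [hb, hg2 i c ν hc hν hμ]
    exact Submodule.smul_mem _ _ (leadLift_mem_eqModule (hL c) (hBmem i.1 c hc))
  · refine hF.eqModule_le.trans (Submodule.span_le.2 ?_)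
    rintro _ ⟨μ, σ, hμ, rfl⟩
    obtain ⟨c, hc⟩ := F.exists_cls_eq_succ h0 σ
    -- By adaptedness of `B`, each equation of class `c` is a combination of those with leading row
    -- `B k`. Their multiplicative derivatives belong to the new basis, up to the divisors created
    -- by coefficients.
    have h1 : F.eqn σ ∈ Submodule.span K
        ((fun k => L c (B k)) '' {k | (k : ℕ) < F.β c.succ}) := by
      have h2 : F.a σ c ∈ F.leadSpace c := Submodule.subset_span ⟨⟨σ, hc⟩, rfl⟩
      rw [hBF c] at h2
      have h3 := Submodule.mem_map_of_mem (f := L c) h2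
      rw [hL c σ hc, Submodule.map_span] at h3
      rwa [← Set.image_comp (L c) (fun k => B k)] at h3
    refine monomialD_smul_mem_of_span F.A_const ?_ h1
    rintro _ ⟨k, hk, rfl⟩ κ hκ
    have hck : F.type k ≤ c := (hF.type_le_iff k c).2 hk
    refine Submodule.subset_span ⟨⟨k, κ + Pi.single c 1⟩, add_single_mem_principal hck κ, ?_⟩
    rw [hb]
    refine hg2 _ c κ hck (fun j hj => Nat.le_zero.1 ?_) rfl
    rw [← hμ j (by rw [hc]; simpa using hj)]
    exact hκ j

theorem mk_monomialD_smul (F : S.SolvedForm Δ) (B : Matrix (Fin m) (Fin m) K) (k : Fin m)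
    (μ : Fin n → ℕ) :
    (S.eqModule Δ).mkQ (monomialD Δ F.A μ • zeroForm Δ (B k)) = F.jet B k μ := rfl

/-- The parametric jets form a basis of the differential module. -/
theorem IsInvolutive.exists_basis_jets (hF : F.IsInvolutive) (h0 : S.NoZeroOrder Δ)
    {B : Matrix (Fin m) (Fin m) K} (hB : IsUnit B.det)
    (hBF : ∀ i, F.leadSpace i = Submodule.span K (B '' {k | (k : ℕ) < F.β i.succ})) :
    ∃ b : Module.Basis (Σ k : Fin m, F.CKIndex k) K (S.DModule Δ),
      ∀ i, b i = F.jet B i.1 i.2.1 := by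
  obtain ⟨b, hb1, hb2, hb3⟩ := hF.exists_basis_equations h0 hB hBF
  let φ : (Fin m → DiffOp Δ) →ₗ[K] S.DModule Δ := (S.eqModule Δ).mkQ.restrictScalars K
  let ε : (Σ k : Fin m, F.CKIndex k) → Σ _ : Fin m, (Fin n → ℕ) := fun i => ⟨i.1, i.2.1⟩
  have hε : Function.Injective ε := by
    rintro ⟨k, μ, hμ⟩ ⟨l, ν, hν⟩ h
    simp only [ε, Sigma.mk.injEq] at h
    obtain ⟨rfl, h⟩ := h
    obtain rfl := eq_of_heq h
    rfl
  have hεp : ∀ i, ε i ∉ F.principal := fun i => not_mem_principal.2 i.2.2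
  have hφ : ∀ i, (φ ∘ b ∘ ε) i = F.jet B i.1 i.2.1 := by
    intro i
    change φ (b (ε i)) = _
    rw [hb1 _ (hεp i)]
    rfl
  have hli : LinearIndependent K (φ ∘ b ∘ ε) := by
    refine (b.linearIndependent.comp ε hε).map ?_
    have hker : LinearMap.ker φ ≤ Submodule.span K (b '' F.principal) := by
      intro x hx
      refine hb3 ?_
      rw [Submodule.restrictScalars_mem]
      exact (Submodule.Quotient.mk_eq_zero _).1 hx
    refine Disjoint.mono_right hker ?_
    rw [Set.range_comp]
    refine b.linearIndependent.disjoint_span_image (Set.disjoint_left.2 ?_)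
    rintro _ ⟨i, rfl⟩
    exact hεp i
  have hsp : ⊤ ≤ Submodule.span K (Set.range (φ ∘ b ∘ ε)) := by
    intro x _
    obtain ⟨v, rfl⟩ := (S.eqModule Δ).mkQ_surjective x
    have hv : v ∈ Submodule.span K (Set.range b) := b.span_eq ▸ Submodule.mem_top
    have : Submodule.span K (Set.range b) ≤
        (Submodule.span K (Set.range (φ ∘ b ∘ ε))).comap φ := by
      refine Submodule.span_le.2 ?_
      rintro _ ⟨⟨k, μ⟩, rfl⟩
      by_cases h : (⟨k, μ⟩ : Σ _ : Fin m, (Fin n → ℕ)) ∈ F.principal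
      · have h1 : φ (b ⟨k, μ⟩) = 0 := (Submodule.Quotient.mk_eq_zero _).2 (hb2 _ h)
        change φ (b ⟨k, μ⟩) ∈ Submodule.span K (Set.range (φ ∘ b ∘ ε))
        rw [h1]
        exact Submodule.zero_mem _
      · exact Submodule.subset_span ⟨⟨k, μ, not_mem_principal.1 h⟩, rfl⟩
    exact this hv
  exact ⟨Module.Basis.mk hli hsp, fun i => (Module.Basis.mk_apply hli hsp i).trans (hφ i)⟩

theorem newD_smul_jet (F : S.SolvedForm Δ) (B : Matrix (Fin m) (Fin m) K) (k : Fin m)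
    (μ : Fin n → ℕ) (j : Fin n) :
    newD Δ F.A j • F.jet B k μ = F.jet B k (μ + Pi.single j 1) := by
  rw [← mk_monomialD_smul, ← mk_monomialD_smul, ← map_smul, ← mul_smul,
    ← monomialD_add_single F.A_const]

end FirstOrderSystem.SolvedForm

/-! ### Lacunary forms on polynomials. -/

section Lacunary

variable {K : Type*} [Field K] {n : ℕ}

/-- The exponents `(2 ^ t, …, 2 ^ t, 0, …, 0)` in the first `r` variables. -/
def IsLacunary (r : ℕ) (μ : Fin n → ℕ) : Prop :=
  ∃ t, ∀ j : Fin n, μ j = if (j : ℕ) < r then 2 ^ t else 0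

open Classical in
/-- The sum of the coefficients with lacunary exponents. -/
noncomputable def lacunaryForm (K : Type*) [Field K] (n r : ℕ) : ((Fin n → ℕ) →₀ K) →ₗ[K] K :=
  Finsupp.linearCombination K fun μ => if IsLacunary r μ then 1 else 0

open Classical in
theorem lacunaryForm_single (r : ℕ) (μ : Fin n → ℕ) :
    lacunaryForm K n r (Finsupp.single μ 1) = if IsLacunary r μ then 1 else 0 := by
  rw [lacunaryForm, Finsupp.linearCombination_single, one_smul]

/-- The form has the constants `0` and `1` as coefficients. -/
theorem lacunaryForm_coeffDer (δ : Derivation ℤ K K) (r : ℕ) (p : (Fin n → ℕ) →₀ K) :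
    lacunaryForm K n r (coeffDer δ p) = δ (lacunaryForm K n r p) := by
  induction p using Finsupp.induction_linear with
  | zero => simp
  | add p q hp hq => simp only [map_add, hp, hq]
  | single μ a =>
    rw [coeffDer_single, lacunaryForm, Finsupp.linearCombination_single,
      Finsupp.linearCombination_single]
    split <;> simp

/-- Powers of two other than `2 ^ (N + 1)` are at distance at least `2 ^ N > N` from it, while
exponents in `s` differ by at most `N` in each variable. So the shift taking `μ₀` to the value `2 ^
(N + 1)` takes no other exponent to a lacunary one. -/
theorem exists_shift_isLacunary (s : Finset (Fin n → ℕ)) (r : ℕ)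
    (hs : ∀ μ ∈ s, ∀ j : Fin n, r ≤ j → μ j = 0) {μ₀ : Fin n → ℕ} (h₀ : μ₀ ∈ s) :
    ∃ ν : Fin n → ℕ, (∀ j : Fin n, r ≤ j → ν j = 0) ∧
      ∀ μ ∈ s, IsLacunary r (μ + ν) ↔ μ = μ₀ := by
  obtain ⟨N, hN⟩ : ∃ N, ∀ μ ∈ s, ∀ j, μ j ≤ N := by
    refine ⟨s.sup fun μ => ∑ j, μ j, fun μ hμ j => ?_⟩
    exact (Finset.single_le_sum (fun _ _ => Nat.zero_le _) (Finset.mem_univ j)).trans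
      (Finset.le_sup (f := fun μ : Fin n → ℕ => ∑ j, μ j) hμ)
  have hpow : N < 2 ^ N := Nat.lt_two_pow_self
  refine ⟨fun j => if (j : ℕ) < r then 2 ^ (N + 1) - μ₀ j else 0, fun j hj => by simp [hj], ?_⟩
  intro μ hμ
  constructor
  · rintro ⟨u, hu⟩
    funext j
    by_cases hj : (j : ℕ) < r
    · have h1 := hu j
      simp only [Pi.add_apply, hj, if_true, pow_succ] at h1
      have h2 := hN μ hμ j
      have h3 := hN μ₀ h₀ j
      rcases lt_trichotomy u (N + 1) with hlt | rfl | hgt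
      · have := Nat.pow_le_pow_right (n := 2) (by omega) (Nat.lt_succ_iff.1 hlt)
        omega
      · rw [pow_succ] at h1
        omega
      · have := Nat.pow_le_pow_right (n := 2) (by omega) hgt
        rw [Nat.succ_eq_add_one, pow_succ, pow_succ] at this
        omega
    · rw [hs μ hμ j (not_lt.1 hj), hs μ₀ h₀ j (not_lt.1 hj)]
  · rintro rfl
    refine ⟨N + 1, fun j => ?_⟩
    simp only [Pi.add_apply]
    split
    · have := hN μ hμ j
      rw [pow_succ]
      omega
    · rw [hs μ hμ j (by omega)]

variable (Δ : CommDerivations K n)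

theorem foldl_stepOp_add (w : List (Fin n)) (p q : (Fin n → ℕ) →₀ K) :
    w.foldl (fun p j => stepOp Δ j p) (p + q) =
      w.foldl (fun p j => stepOp Δ j p) p + w.foldl (fun p j => stepOp Δ j p) q := by
  induction w generalizing p q with
  | nil => rfl
  | cons j w ih => rw [List.foldl_cons, map_add, ih, List.foldl_cons, List.foldl_cons]

/-- The polynomials in the first `r` variables all of whose derivatives are killed by the lacunary
form. -/
noncomputable def lacunaryRadical (r : ℕ) : Submodule K ((Fin n → ℕ) →₀ K) where
  carrier := {p | (∀ μ ∈ p.support, ∀ j : Fin n, r ≤ j → μ j = 0) ∧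
    ∀ w : List (Fin n), (∀ j ∈ w, (j : ℕ) < r) →
      lacunaryForm K n r (w.foldl (fun p j => stepOp Δ j p) p) = 0}
  zero_mem' := by
    have hfold : ∀ w : List (Fin n),
        w.foldl (fun p j => stepOp Δ j p) (0 : (Fin n → ℕ) →₀ K) = 0 := by
      intro w
      induction w with
      | nil => rfl
      | cons j w ih => rw [List.foldl_cons, map_zero, ih]
    exact ⟨by simp, fun w _ => by rw [hfold, map_zero]⟩
  add_mem' := by
    rintro p q ⟨hp, hp'⟩ ⟨hq, hq'⟩
    classical
    refine ⟨fun μ hμ => ?_, fun w hw => ?_⟩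
    · rcases Finset.mem_union.1 (Finsupp.support_add hμ) with h | h
      · exact hp μ h
      · exact hq μ h
    · rw [foldl_stepOp_add, map_add, hp' w hw, hq' w hw, add_zero]
  smul_mem' := by
    rintro a p ⟨hp, hp'⟩
    refine ⟨fun μ hμ => hp μ (Finsupp.support_smul hμ), fun w hw => ?_⟩
    -- The induction replaces `p` by `stepOp Δ j p`, for which only the vanishing condition is
    -- needed.
    clear hp
    induction w generalizing p a with
    | nil => simpa using Or.inr (hp' [] (by simp))
    | cons j w ih =>
      rw [List.foldl_cons, stepOp_smul, foldl_stepOp_add, map_add]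
      have hw' : ∀ i ∈ w, (i : ℕ) < r := fun i hi => hw i (List.mem_cons_of_mem j hi)
      have hj : (j : ℕ) < r := hw j List.mem_cons_self
      rw [ih _ (fun v hv => ?_) hw', ih _ hp' hw', add_zero]
      exact hp' (j :: v) fun i hi => (List.mem_cons.1 hi).elim (fun h => h ▸ hj) (hv i)

variable {Δ} {r : ℕ}

theorem coeffDer_mem_lacunaryRadical {p : (Fin n → ℕ) →₀ K} (hp : p ∈ lacunaryRadical Δ r)
    (j : Fin n) : coeffDer (Δ.der j) p ∈ lacunaryRadical Δ r := by
  refine ⟨fun μ hμ => hp.1 μ ?_, fun w hw => ?_⟩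
  · rw [Finsupp.mem_support_iff] at hμ ⊢
    intro h
    exact hμ (by rw [coeffDer_apply, h, map_zero])
  · have hfold : ∀ (w : List (Fin n)) p,
        w.foldl (fun p j => stepOp Δ j p) (coeffDer (Δ.der j) p) =
          coeffDer (Δ.der j) (w.foldl (fun p j => stepOp Δ j p) p) := by
      intro w
      induction w with
      | nil => simp
      | cons i w ih => intro p; rw [List.foldl_cons, ← coeffDer_stepOp, ih, List.foldl_cons]
    rw [hfold, lacunaryForm_coeffDer, hp.2 w hw, map_zero]

theorem stepOp_mem_lacunaryRadical {p : (Fin n → ℕ) →₀ K} (hp : p ∈ lacunaryRadical Δ r)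
    {j : Fin n} (hj : (j : ℕ) < r) : stepOp Δ j p ∈ lacunaryRadical Δ r := by
  classical
  refine ⟨fun μ hμ => ?_, fun w hw => ?_⟩
  · rw [stepOp_apply] at hμ
    rcases Finset.mem_union.1 (Finsupp.support_add hμ) with h | h
    · exact (coeffDer_mem_lacunaryRadical hp j).1 μ h
    · obtain ⟨κ, hκ, rfl⟩ := Finset.mem_image.1 (Finsupp.mapDomain_support h)
      intro i hi
      have hij : i ≠ j := by
        rintro rfl
        omega
      simp [hp.1 κ hκ i hi, hij]
  · exact hp.2 (j :: w) fun i hi => (List.mem_cons.1 hi).elim (fun h => h ▸ hj) (hw i)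

/-- The elements with constant coefficients of the radical are stable under shifts. -/
theorem mapDomain_mem_lacunaryRadical {p : (Fin n → ℕ) →₀ K} (hp : p ∈ lacunaryRadical Δ r)
    (hc : ∀ j, coeffDer (Δ.der j) p = 0) (ν : Fin n → ℕ) (hν : ∀ j : Fin n, r ≤ j → ν j = 0) :
    Finsupp.mapDomain (· + ν) p ∈ lacunaryRadical Δ r := by
  suffices Finsupp.mapDomain (· + ν) p ∈ lacunaryRadical Δ r ∧
    ∀ j, coeffDer (Δ.der j) (Finsupp.mapDomain (· + ν) p) = 0 from this.1
  induction ν using exponent_induction with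
  | zero =>
    have : (fun μ : Fin n → ℕ => μ + 0) = id := funext fun μ => add_zero μ
    rw [this, Finsupp.mapDomain_id]
    exact ⟨hp, hc⟩
  | add ν j ih =>
    have hj : (j : ℕ) < r := by
      by_contra h
      simpa using hν j (not_lt.1 h)
    obtain ⟨h1, h2⟩ := ih fun i hi => Nat.eq_zero_of_add_eq_zero_right (hν i hi)
    have hcomp : Finsupp.mapDomain (· + (ν + Pi.single j 1)) p =
        shift K j (Finsupp.mapDomain (· + ν) p) := by
      rw [shift, Finsupp.lmapDomain_apply, ← Finsupp.mapDomain_comp]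
      congr 1
      funext μ
      exact (add_assoc _ _ _).symm
    rw [hcomp]
    refine ⟨?_, fun i => ?_⟩
    · have := stepOp_mem_lacunaryRadical h1 hj
      rwa [stepOp_apply, h2, zero_add] at this
    · rw [coeffDer_shift, h2, map_zero]

/-- Induction on the size of the support: derivatives of a normalised element lose the exponent
`μ₀`, hence vanish. The element then has constant coefficients, may be shifted freely, and a shift
isolating `μ₀` contradicts the vanishing of the form. -/
theorem lacunaryRadical_eq_bot : lacunaryRadical Δ r = ⊥ := by
  rw [eq_bot_iff]
  intro p hp
  rw [Submodule.mem_bot]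
  induction hN : p.support.card using Nat.strong_induction_on generalizing p with
  | _ N ih =>
    by_contra hne
    obtain ⟨μ₀, hμ₀⟩ := Finsupp.support_nonempty_iff.2 hne
    have hμ₀' := Finsupp.mem_support_iff.1 hμ₀
    set p' := (p μ₀)⁻¹ • p with hp'
    have hmem : p' ∈ lacunaryRadical Δ r := Submodule.smul_mem _ _ hp
    have hone : p' μ₀ = 1 := by simp [hp', hμ₀']
    have hconst : ∀ j, coeffDer (Δ.der j) p' = 0 := by
      intro j
      refine ih _ ?_ (coeffDer_mem_lacunaryRadical hmem j) rfl
      rw [← hN]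
      refine Finset.card_lt_card ((Finset.ssubset_iff_of_subset ?_).2 ⟨μ₀, hμ₀, ?_⟩)
      · intro μ hμ
        rw [Finsupp.mem_support_iff] at hμ ⊢
        intro h
        exact hμ (by simp [hp', h])
      · simp [hone]
    obtain ⟨ν, hν, hlac⟩ := exists_shift_isLacunary p'.support r hmem.1
      (Finsupp.mem_support_iff.2 (by rw [hone]; exact one_ne_zero))
    have h := (mapDomain_mem_lacunaryRadical hmem hconst ν hν).2 [] (by simp)
    rw [List.foldl_nil, lacunaryForm, Finsupp.linearCombination_mapDomain,
      Finsupp.linearCombination_apply, Finsupp.sum, Finset.sum_eq_single μ₀] at h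
    · simp [hone, (hlac μ₀ (Finsupp.mem_support_iff.2 (by rw [hone]; exact one_ne_zero))).2 rfl]
        at h
    · intro μ hμ hμμ
      simp [mt (hlac μ hμ).1 hμμ]
    · intro h
      rw [Finsupp.notMem_support_iff] at h
      simp [h]

theorem le_lacunaryRadical {W : Submodule K ((Fin n → ℕ) →₀ K)}
    (h1 : ∀ p ∈ W, ∀ μ ∈ p.support, ∀ j : Fin n, r ≤ j → μ j = 0)
    (h2 : ∀ j : Fin n, (j : ℕ) < r → ∀ p ∈ W, stepOp Δ j p ∈ W)
    (h3 : ∀ p ∈ W, lacunaryForm K n r p = 0) : W ≤ lacunaryRadical Δ r := by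
  intro p hp
  refine ⟨h1 p hp, fun w hw => ?_⟩
  induction w generalizing p with
  | nil => exact h3 p hp
  | cons j w ih =>
    exact ih (h2 j (hw j List.mem_cons_self) p hp) fun i hi => hw i (List.mem_cons_of_mem j hi)

end Lacunary

/-! ### Lacunary sections separate the points of the differential module. -/

namespace FirstOrderSystem.SolvedForm

open DiffOp

variable {K : Type*} [Field K] {n m : ℕ} {Δ : CommDerivations K n} {S : FirstOrderSystem K n m}
  {F : S.SolvedForm Δ} (b : Module.Basis (Σ k : Fin m, F.CKIndex k) K (S.DModule Δ))

open Classical in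
/-- The component attached to the `k`-th unknown, as a polynomial. -/
noncomputable def component (k : Fin m) : S.DModule Δ →ₗ[K] ((Fin n → ℕ) →₀ K) :=
  b.constr K fun i => if i.1 = k then Finsupp.single i.2.1 1 else 0

open Classical in
theorem component_basis (k : Fin m) (i : Σ k : Fin m, F.CKIndex k) :
    component b k (b i) = if i.1 = k then Finsupp.single i.2.1 1 else 0 :=
  b.constr_basis K _ i

theorem component_apply (k : Fin m) (x : S.DModule Δ) (μ : F.CKIndex k) :
    component b k x μ.1 = b.repr x ⟨k, μ⟩ := by
  have h : Finsupp.lapply μ.1 ∘ₗ component b k = b.coord ⟨k, μ⟩ := by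
    refine b.ext fun i => ?_
    rw [LinearMap.comp_apply, component_basis, Module.Basis.coord_apply, Module.Basis.repr_self]
    obtain ⟨l, ν⟩ := i
    by_cases hl : l = k
    · subst hl
      by_cases hν : ν = μ
      · subst hν
        simp
      · have hν' : ν.1 ≠ μ.1 := fun h => hν (Subtype.ext h)
        simp [hν, hν']
    · simp [hl]
  exact LinearMap.congr_fun h x

theorem component_support (k : Fin m) (x : S.DModule Δ) (μ : Fin n → ℕ)
    (hμ : μ ∈ (component b k x).support) (j : Fin n) (hj : F.type k ≤ j) : μ j = 0 := by
  have h : component b k x ∈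
      Finsupp.supported K K {μ : Fin n → ℕ | ∀ j : Fin n, F.type k ≤ j → μ j = 0} := by
    have hx : x ∈ Submodule.span K (Set.range b) := b.span_eq ▸ Submodule.mem_top
    have hle : Submodule.span K (Set.range b) ≤ (Finsupp.supported K K
        {μ : Fin n → ℕ | ∀ j : Fin n, F.type k ≤ j → μ j = 0}).comap (component b k) := by
      refine Submodule.span_le.2 ?_
      rintro _ ⟨⟨l, ν⟩, rfl⟩
      change component b k (b ⟨l, ν⟩) ∈ Finsupp.supported K K _
      rw [component_basis]
      by_cases hl : l = k
      · subst hl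
        rw [if_pos rfl]
        exact Finsupp.single_mem_supported K _ ν.2
      · rw [if_neg hl]
        exact Submodule.zero_mem _
    exact hle hx
  exact h hμ j hj

/-- The section attached to the `k`-th unknown, with lacunary data. -/
noncomputable def lacunarySection (k : Fin m) : S.InverseSystem Δ :=
  lacunaryForm K n (F.type k) ∘ₗ component b k

theorem lacunarySection_basis_of_ne {k l : Fin m} (h : l ≠ k) (μ : F.CKIndex l) :
    lacunarySection b k (b ⟨l, μ⟩) = 0 := by
  rw [lacunarySection, LinearMap.comp_apply, component_basis, if_neg h, map_zero]

theorem linearIndependent_lacunarySection : LinearIndependent K (lacunarySection b) := by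
  rw [Fintype.linearIndependent_iff]
  intro g hg k
  -- The lacunary exponent with `t = 0`: on this jet the `k`-th section is `1` and the others
  -- vanish.
  have hμ : ∀ j : Fin n, F.type k ≤ j → (if (j : ℕ) < F.type k then 2 ^ 0 else 0) = 0 :=
    fun j hj => if_neg (not_lt.2 hj)
  let μ : F.CKIndex k := ⟨_, hμ⟩
  have h := LinearMap.congr_fun hg (b ⟨k, μ⟩)
  rw [LinearMap.sum_apply, Finset.sum_eq_single k] at h
  · rw [LinearMap.smul_apply, lacunarySection, LinearMap.comp_apply, component_basis, if_pos rfl,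
      lacunaryForm_single, if_pos ⟨0, fun j => rfl⟩] at h
    simpa using h
  · intro l _ hl
    rw [LinearMap.smul_apply, lacunarySection_basis_of_ne b hl.symm, smul_zero]
  · simp

variable {b} {B : Matrix (Fin m) (Fin m) K}

/-- A derivation numbered at most the type keeps a parametric jet parametric, so no reduction by the
equations occurs. -/
theorem newD_smul_basis (hb : ∀ i, b i = F.jet B i.1 i.2.1) {j : Fin n} {k : Fin m}
    (hj : (j : ℕ) < F.type k) (μ : F.CKIndex k) :
    ∃ ν : F.CKIndex k, ν.1 = μ.1 + Pi.single j 1 ∧ newD Δ F.A j • b ⟨k, μ⟩ = b ⟨k, ν⟩ := by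
  refine ⟨⟨μ.1 + Pi.single j 1, fun i hi => ?_⟩, rfl, ?_⟩
  · have hij : i ≠ j := by
      rintro rfl
      omega
    simp [μ.2 i hi, hij]
  · rw [hb, hb, newD_smul_jet]

/-- On the elements without components of type less than `t`, the first `t` derivations act on
components as on polynomials. -/
theorem newD_smul_mem_and_component (hb : ∀ i, b i = F.jet B i.1 i.2.1) {j : Fin n} {t : ℕ}
    (hj : (j : ℕ) < t) (k : Fin m) {x : S.DModule Δ}
    (hx : x ∈ Submodule.span K (b '' {i | t ≤ F.type i.1})) :
    newD Δ F.A j • x ∈ Submodule.span K (b '' {i | t ≤ F.type i.1}) ∧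
      component b k (newD Δ F.A j • x) =
        stepOp (Δ.change F.A F.A_const) j (component b k x) := by
  induction hx using Submodule.span_induction with
  | mem x hx =>
    obtain ⟨⟨l, μ⟩, hl, rfl⟩ := hx
    obtain ⟨ν, hν, h⟩ := newD_smul_basis hb (hj.trans_le hl) μ
    rw [h]
    refine ⟨Submodule.subset_span ⟨⟨l, ν⟩, hl, rfl⟩, ?_⟩
    rw [component_basis, component_basis]
    simp only
    split
    · rw [stepOp_apply, coeffDer_single, shift_single, Derivation.map_one_eq_zero,
        Finsupp.single_zero, zero_add, hν]
    · rw [map_zero]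
  | zero => simp
  | add x y _ _ hx hy =>
    rw [smul_add, map_add, map_add, map_add, hx.2, hy.2]
    exact ⟨Submodule.add_mem _ hx.1 hy.1, rfl⟩
  | smul a x hx' hx =>
    rw [newD_smul_smul F.A_const, map_add, map_smul _ a, map_smul _ a x, stepOp_smul,
      map_smul _ ((Δ.change F.A F.A_const).der j a), hx.2]
    exact ⟨Submodule.add_mem _ (Submodule.smul_mem _ _ hx.1) (Submodule.smul_mem _ _ hx'), rfl⟩

/-- No nonzero differential submodule is killed by the lacunary sections. -/
theorem eq_bot_of_lacunarySection_eq_zero (hb : ∀ i, b i = F.jet B i.1 i.2.1)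
    {N : Submodule K (S.DModule Δ)} (hN : ∀ j, ∀ x ∈ N, newD Δ F.A j • x ∈ N)
    (hf : ∀ k, ∀ x ∈ N, lacunarySection b k x = 0) : N = ⊥ := by
  rw [eq_bot_iff]
  intro x hx
  rw [Submodule.mem_bot]
  by_contra hne
  have hsupp : (b.repr x).support.Nonempty := by
    rw [Finsupp.support_nonempty_iff]
    simpa using hne
  -- Minimality of the type makes the first `F.type k` derivations act without reduction on every
  -- component of `x`.
  obtain ⟨⟨k, μ⟩, hi, hmin⟩ := Finset.exists_min_image _ (fun i => F.type i.1) hsupp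
  have hxL : x ∈ Submodule.span K (b '' {i | F.type k ≤ F.type i.1}) :=
    b.mem_span_image.2 fun i hi => hmin i hi
  have hle : (N ⊓ Submodule.span K (b '' {i | F.type k ≤ F.type i.1})).map (component b k) ≤
      lacunaryRadical (Δ.change F.A F.A_const) (F.type k) := by
    refine le_lacunaryRadical ?_ ?_ ?_
    · rintro _ ⟨y, -, rfl⟩ ν hν j hj
      exact component_support b k y ν hν j hj
    · rintro j hj _ ⟨y, ⟨hyN, hyL⟩, rfl⟩
      obtain ⟨h1, h2⟩ := newD_smul_mem_and_component hb hj k hyL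
      exact ⟨_, ⟨hN j y hyN, h1⟩, h2⟩
    · rintro _ ⟨y, ⟨hyN, -⟩, rfl⟩
      exact hf k y hyN
  rw [lacunaryRadical_eq_bot] at hle
  have h0 : component b k x = 0 := hle ⟨x, ⟨hx, hxL⟩, rfl⟩
  rw [Finsupp.mem_support_iff, ← component_apply, h0] at hi
  exact hi rfl

end FirstOrderSystem.SolvedForm

/-! ### The Spencer action, duality and density. -/

section Density

variable {K : Type*} [Field K] {n m : ℕ} {Δ : CommDerivations K n}

namespace Spencer

variable {N : Type*} [AddCommGroup N] [Module (DiffOp Δ) N] [Module K N]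
  [IsScalarTower K (DiffOp Δ) N]

theorem coeff_smul_apply (a : K) (f : N →ₗ[K] K) (x : N) :
    (DiffOp.coeff Δ a • f) x = a * f x := by
  change (action (Δ := Δ) (N := N) (DiffOp.mk Δ (FreeAlgebra.ι ℤ (Sum.inl a)))) f x = _
  rw [action, DiffOp.mk]
  erw [RingQuot.lift_mkRingHom_apply]
  rw [RingHom.coe_coe, freeAction_inl, scalarHom_apply]

theorem d_smul_apply (i : Fin n) (f : N →ₗ[K] K) (x : N) :
    (DiffOp.d Δ i • f) x = Δ.der i (f x) - f (DiffOp.d Δ i • x) := by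
  change (action (Δ := Δ) (N := N) (DiffOp.mk Δ (FreeAlgebra.ι ℤ (Sum.inr i)))) f x = _
  rw [action, DiffOp.mk]
  erw [RingQuot.lift_mkRingHom_apply]
  rw [RingHom.coe_coe, freeAction_inr, opHom_apply]

/-- A differential submodule of the dual as a space over `K`. -/
noncomputable def dualSubspace (H : Submodule (DiffOp Δ) (N →ₗ[K] K)) :
    Submodule K (Module.Dual K N) where
  carrier := H
  add_mem' := H.add_mem
  zero_mem' := H.zero_mem
  smul_mem' a f hf := by
    have h : a • f = DiffOp.coeff Δ a • f := LinearMap.ext fun x => (coeff_smul_apply a f x).symm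
    rw [h]
    exact H.smul_mem _ hf

/-- In `(d_i f)(x) = ∂_i (f x) - f (d_i x)` both `f` and `d_i f` kill `x`, hence `f` kills `d_i x`.
-/
theorem d_smul_mem_dualCoannihilator (H : Submodule (DiffOp Δ) (N →ₗ[K] K)) (i : Fin n) {x : N}
    (hx : x ∈ (dualSubspace H).dualCoannihilator) :
    DiffOp.d Δ i • x ∈ (dualSubspace H).dualCoannihilator := by
  rw [Submodule.mem_dualCoannihilator] at hx ⊢
  intro f hf
  have h := hx (DiffOp.d Δ i • f) (H.smul_mem _ hf)
  rw [d_smul_apply, hx f hf, map_zero, zero_sub, neg_eq_zero] at h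
  exact h

end Spencer

theorem Subspace.eq_top_of_separating {V : Type*} [AddCommGroup V] [Module K V]
    [FiniteDimensional K V] (X : Submodule K (Module.Dual K V))
    (h : ∀ v, (∀ φ ∈ X, φ v = 0) → v = 0) : X = ⊤ := by
  have h1 : X.dualCoannihilator = ⊥ := by
    rw [eq_bot_iff]
    intro v hv
    exact h v ((Submodule.mem_dualCoannihilator _).1 hv)
  rw [← Subspace.dualCoannihilator_dualAnnihilator_eq (W := X), h1,
    Submodule.dualAnnihilator_bot]

namespace FirstOrderSystem

variable {S : FirstOrderSystem K n m}

instance finiteDimensional_orderLE (q : ℕ) : FiniteDimensional K (DiffOp.orderLE Δ q) := by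
  refine FiniteDimensional.span_of_finite K ?_
  refine ((List.finite_length_le (Fin n) q).image fun l => (l.map (DiffOp.d Δ)).prod).subset ?_
  rintro _ ⟨l, hl, rfl⟩
  exact ⟨l, hl, rfl⟩

instance finiteDimensional_filt (q : ℕ) : FiniteDimensional K (S.filt Δ q) := by
  let φ : (Fin m → DiffOp.orderLE Δ q) →ₗ[K] S.DModule Δ :=
    ((S.eqModule Δ).mkQ.restrictScalars K) ∘ₗ
      LinearMap.pi fun k => (DiffOp.orderLE Δ q).subtype ∘ₗ LinearMap.proj k
  have hle : S.filt Δ q ≤ LinearMap.range φ := by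
    refine Submodule.span_le.2 ?_
    rintro _ ⟨v, hv, rfl⟩
    exact ⟨fun k => ⟨v k, hv k⟩, rfl⟩
  exact Submodule.finiteDimensional_of_le hle

/-- Restrictions to the finite dimensional `M_q` of a separating space of forms still separate, and
so fill the dual. -/
theorem generates_of_separating {ι : Type*} {f : ι → S.InverseSystem Δ}
    (h : (Spencer.dualSubspace (Submodule.span (DiffOp Δ) (Set.range f))).dualCoannihilator = ⊥) :
    S.Generates Δ f := by
  intro q g
  set H := Submodule.span (DiffOp Δ) (Set.range f) with hH
  have htop : (Spencer.dualSubspace H).map (S.filt Δ q).dualRestrict = ⊤ := by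
    refine Subspace.eq_top_of_separating _ fun v hv => ?_
    have hv' : (v : S.DModule Δ) ∈ (Spencer.dualSubspace H).dualCoannihilator :=
      (Submodule.mem_dualCoannihilator _).2 fun φ hφ => hv _ ⟨φ, hφ, rfl⟩
    rw [h, Submodule.mem_bot] at hv'
    exact Subtype.ext hv'
  have hg : g ∈ (Spencer.dualSubspace H).map (S.filt Δ q).dualRestrict := htop ▸ Submodule.mem_top
  obtain ⟨φ, hφ, hφg⟩ := hg
  exact ⟨φ, hφ, hφg⟩

theorem span_eq_top_of_separating [FiniteDimensional K (S.DModule Δ)] {ι : Type*}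
    {f : ι → S.InverseSystem Δ}
    (h : (Spencer.dualSubspace (Submodule.span (DiffOp Δ) (Set.range f))).dualCoannihilator = ⊥) :
    Submodule.span (DiffOp Δ) (Set.range f) = ⊤ := by
  have htop := Subspace.eq_top_of_separating
    (Spencer.dualSubspace (Submodule.span (DiffOp Δ) (Set.range f))) fun v hv => by
      have hv' := (Submodule.mem_dualCoannihilator _).2 hv
      rwa [h, Submodule.mem_bot] at hv'
  rw [eq_top_iff]
  intro g _
  have hg : g ∈ Spencer.dualSubspace (Submodule.span (DiffOp Δ) (Set.range f)) :=
    htop ▸ Submodule.mem_top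
  exact hg

namespace SolvedForm

variable {F : S.SolvedForm Δ} {b : Module.Basis (Σ k : Fin m, F.CKIndex k) K (S.DModule Δ)}
  {B : Matrix (Fin m) (Fin m) K}

theorem dualCoannihilator_span_lacunarySection (hb : ∀ i, b i = F.jet B i.1 i.2.1) :
    (Spencer.dualSubspace
      (Submodule.span (DiffOp Δ) (Set.range (lacunarySection b)))).dualCoannihilator = ⊥ := by
  refine eq_bot_of_lacunarySection_eq_zero hb (fun j x hx => ?_) fun k x hx => ?_
  · rw [newD, Finset.sum_smul]
    refine Submodule.sum_mem _ fun l _ => ?_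
    rw [smul_assoc]
    exact Submodule.smul_mem _ _ (Spencer.d_smul_mem_dualCoannihilator _ l hx)
  · exact (Submodule.mem_dualCoannihilator _).1 hx _ (Submodule.subset_span ⟨k, rfl⟩)

theorem existsUnique_section (hb : ∀ i, b i = F.jet B i.1 i.2.1)
    (c : (k : Fin m) → F.CKIndex k → K) :
    ∃! f : S.InverseSystem Δ, ∀ k μ, f (F.jet B k μ.1) = c k μ := by
  refine ⟨b.constr K fun i => c i.1 i.2, fun k μ => ?_, fun f hf => b.ext fun i => ?_⟩
  · have := b.constr_basis K (fun i => c i.1 i.2) ⟨k, μ⟩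
    rwa [hb] at this
  · rw [b.constr_basis, hb, hf]

end SolvedForm

end FirstOrderSystem

end Density

/-! ### The main theorem. -/

theorem theorem3p38 {K : Type*} [Field K] [CharZero K] {n m : ℕ} (Δ : CommDerivations K n)
    (S : FirstOrderSystem K n m) (hS : S.IsInvolutive Δ) (h0 : S.NoZeroOrder Δ) :
    ((∀ (a : K) (f : S.InverseSystem Δ) (x : S.DModule Δ),
        (DiffOp.coeff Δ a • f) x = a * f x) ∧
      (∀ (i : Fin n) (f : S.InverseSystem Δ) (x : S.DModule Δ),
        (DiffOp.d Δ i • f) x = Δ.der i (f x) - f (DiffOp.d Δ i • x))) ∧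
    (∃ f : Fin m → S.InverseSystem Δ,
      LinearIndependent K f ∧ S.Generates Δ f ∧
      (FiniteDimensional K (S.DModule Δ) →
        Submodule.span (DiffOp Δ) (Set.range f) = ⊤)) ∧
    (∀ F : S.SolvedForm Δ, F.IsInvolutive →
      ∃ B : Matrix (Fin m) (Fin m) K, IsUnit B.det ∧
        (∀ c : (k : Fin m) → F.CKIndex k → K,
          ∃! f : S.InverseSystem Δ, ∀ k μ, f (F.jet B k μ.1) = c k μ) ∧
        ∃ f : Fin m → S.InverseSystem Δ,
          (∀ k l, l ≠ k → ∀ μ : F.CKIndex l, f k (F.jet B l μ.1) = 0) ∧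
          LinearIndependent K f ∧ S.Generates Δ f) := by
  refine ⟨⟨Spencer.coeff_smul_apply, Spencer.d_smul_apply⟩, ?_, ?_⟩
  · obtain ⟨F, hF⟩ := hS
    obtain ⟨B, hB, hBF⟩ := hF.exists_adapted
    obtain ⟨b, hb⟩ := hF.exists_basis_jets h0 hB hBF
    have hsep := FirstOrderSystem.SolvedForm.dualCoannihilator_span_lacunarySection hb
    exact ⟨_, FirstOrderSystem.SolvedForm.linearIndependent_lacunarySection b,
      FirstOrderSystem.generates_of_separating hsep,
      fun _ => FirstOrderSystem.span_eq_top_of_separating hsep⟩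
  · intro F hF
    obtain ⟨B, hB, hBF⟩ := hF.exists_adapted
    obtain ⟨b, hb⟩ := hF.exists_basis_jets h0 hB hBF
    have hsep := FirstOrderSystem.SolvedForm.dualCoannihilator_span_lacunarySection hb
    refine ⟨B, hB, FirstOrderSystem.SolvedForm.existsUnique_section hb, _, fun k l hlk μ => ?_,
      FirstOrderSystem.SolvedForm.linearIndependent_lacunarySection b,
      FirstOrderSystem.generates_of_separating hsep⟩
    rw [← hb ⟨l, μ⟩]
    exact FirstOrderSystem.SolvedForm.lacunarySection_basis_of_ne b hlk μ
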